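/- Let $n\ge 2$, let $\Omega\subseteq\mathbb{R}^n$ be open and connected (and nonempty), and let $u\in C^2(\Omega)$. Suppose there are one-variable real functions $f$ and $g$, with $f>0$ on $\mathcal I:=u(\Omega)$, such that $$|\nabla u(x)|=f(u(x)),\qquad \Delta u(x)=g(u(x))\qquad\text{for all }x\in\Omega .$$ Write $$\Delta_1u:=\frac{\Delta u-|\nabla u|^{-2}\,\langle (\mathrm{Hess}\,u)\nabla u,\nabla u\rangle}{|\nabla u|}$$ for the 1-Laplacian of $u$, where $\mathrm{Hess}\,u$ is the Hessian matrix. Then $\mathcal I\subseteq\mathbb{R}$ is an open interval, $f\in C^1(\mathcal I)$ and $g\in C(\mathcal I)$. For $x_0\in\Omega$ put $$F(t):=\int_{u(x_0)}^t\frac{ds}{f(s)},\qquad t\in\mathcal I .$$ (a) If $x_0\in\Omega$ and $\Delta_1u(x_0)=0$, then $g(t)=f(t)f'(t)$ for all $t\in\mathcal I$. Moreover $F\colon\mathcal I\to F(\mathcal I)$ is invertible and, with $U\colon F(\mathcal I)\to\mathcal I$ its inverse, there is a constant unit vector $q\in\mathbb{R}^n$ such that, for all $x\in\Omega$, $q^T(x-x_0)\in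 F(\mathcal I)$ and $$u(x)=U\big(q^T(x-x_0)\big).$$ (b) If $x_0\in\Omega$ and $C_1:=\Delta_1u(x_0)>0$, then there is an integer $2\le k\le n$ such that, for all $t\in\mathcal I$, $$F_k(t):=\frac{k-1}{C_1}+F(t)>0\qquad\text{and}\qquad g(t)=f(t)\left(f'(t)+\frac{k-1}{F_k(t)}\right).$$ Moreover $F_k\colon\mathcal I\to F_k(\mathcal I)$ is invertible and, with $U_k\colon F_k(\mathcal I)\to\mathcal I$ its inverse, there are a constant real symmetric $n\times n$ matrix $R_0$ with $R_0R_0=R_0$ and $\operatorname{tr}R_0=k$ (a projection of rank $k$) and a point $x_*\in\mathbb{R}^n$ such that, for all $x\in\Omega$, $R_0(x-x_*)\ne0$, $|R_0(x-x_*)|\in F_k(\mathcal I)$ and $$u(x)=U_k\big(|R_0(x-x_*)|\big).$$ -/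

import Mathlib

open scoped Gradient Laplacian RealInnerProductSpace

noncomputable section

namespace Segre

/-- The normalized infinity-Laplacian `|∇u|⁻² ∇u (Hess u) ∇uᵀ` of `u` at `x`; the Hessian is the
second derivative of `u` at `x` as a bilinear form. -/
def normalizedInftyLaplacian {n : ℕ} (u : EuclideanSpace ℝ (Fin n) → ℝ)
    (x : EuclideanSpace ℝ (Fin n)) : ℝ :=
  (‖∇ u x‖ ^ 2)⁻¹ * iteratedFDeriv ℝ 2 u x ![∇ u x, ∇ u x]

/-- The 1-Laplacian `(Δu - Δ_∞^N u) / |∇u|` of `u` at `x` (meaningful where `∇u ≠ 0`). -/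
def oneLaplacian {n : ℕ} (u : EuclideanSpace ℝ (Fin n) → ℝ)
    (x : EuclideanSpace ℝ (Fin n)) : ℝ :=
  ((Δ u) x - normalizedInftyLaplacian u x) / ‖∇ u x‖

/-- The symmetric `n × n` real projection matrices of dimension (trace) `k`. -/
def Pr (n k : ℕ) : Set (Matrix (Fin n) (Fin n) ℝ) :=
  {R | R.IsSymm ∧ R * R = R ∧ R.trace = (k : ℝ)}

/-- The function `F(t) = ∫_a^t ds / f(s)`. -/
def recipPrimitive (f : ℝ → ℝ) (a t : ℝ) : ℝ :=
  ∫ s in a..t, 1 / f s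

/-- The function `F_k(t) = (k - 1) / C + ∫_a^t ds / f(s)`. -/
def shiftedPrimitive (f : ℝ → ℝ) (a C : ℝ) (k : ℕ) (t : ℝ) : ℝ :=
  ((k : ℝ) - 1) / C + recipPrimitive f a t

end Segre

end

/-!
Let `F` be a primitive of `1/f`. Then `w = F ∘ u` is a `C²` function with `|∇w| = 1`, and its
Laplacian `g/f - f'` is a function of `w` which equals the 1-Laplacian of `u` (`exists_isoDist`).
So the level sets of `u` are parallel hypersurfaces of constant mean curvature, and the theorem is
the classical statement that they are pieces of hyperplanes, spheres or cylinders. Here `u` is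
only of class `C²`, so the usual proofs, which differentiate the second fundamental form, are not
available.

Write `N` and `A` for the gradient and the Hessian of `w`.

* The field `N` is constant along the straight lines in its direction. Differentiating this with
  respect to the foot point shows that along such a line the eigenvalues `lᵢ` of `A` become
  `lᵢ / (1 + t lᵢ)`. The Laplacian of `w` on nearby level sets is therefore `∑ lᵢ / (1 + t lᵢ)`, the
  logarithmic derivative of `∏ (1 + t lᵢ)`, so that the value of `w` determines the eigenvalues of
  `A` with their multiplicities (`IsoDist.eventually_eigenvalues`).

* All nonzero eigenvalues at a point are equal (`IsoDist.eigenvalues_eq`). By the previous step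
  the parallel hypersurfaces at any nonfocal distance again belong to a function of the same kind
  (`IsoDist.exists_parallel`), and at a large distance all nonzero eigenvalues are positive. If
  then `m` is the largest one at `x₀` and `s = w - w(x₀) + 1/m`, the Hessian `s A + N ⊗ N` of
  `s²/2` is at most the identity near `x₀`, with equality at `x₀` in the principal directions of
  curvature `m`. The second derivative of `s²/2` in such a direction has a maximum at `x₀`, while
  its Laplacian would be positive there if another positive eigenvalue existed
  (`IsoDist.eigenvalues_of_nonneg`). The maximum principle is applied to second difference
  quotients, so two derivatives suffice.

* If the Laplacian of `w` vanishes at a point, then so does `A`, hence `A = 0` everywhere and `w`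
  is affine (`IsoDist.eq_inner_of_trace_eq_zero`). If it is positive, then `s A + N ⊗ N` is a
  projection of constant rank `k`; its trace is constant, so a strong maximum principle shows that
  its range does not move (`IsoDist.eventually_sqHess_eq`). The gradient `s N` of `s²/2` is thus
  an affine map with linear part a projection `R`, and `s`, the length of this gradient, is the
  distance from an affine subspace (`IsoDist.eq_norm_of_trace_pos`).
-/

namespace Isoparametric

open Set Filter Topology Metric

/-! ### Functions with gradient and Hessian; the weak maximum principle -/

section

variable {E : Type*} [NormedAddCommGroup E] [InnerProductSpace ℝ E] [FiniteDimensional ℝ E]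

/-- On the set `S`, the function `z` has gradient field `Z`, and `Z` has derivative `H`; thus `H x`
is the Hessian of `z` at `x`, regarded as an endomorphism. -/
structure HasGradHessOn (S : Set E) (z : E → ℝ) (Z : E → E) (H : E → E →L[ℝ] E) : Prop where
  grad : ∀ x ∈ S, HasGradientAt z (Z x) x
  hess : ∀ x ∈ S, HasFDerivAt Z (H x) x

namespace HasGradHessOn

variable {S T : Set E} {z z₁ z₂ : E → ℝ} {Z Z₁ Z₂ : E → E} {H H₁ H₂ : E → E →L[ℝ] E}

lemma mono (h : HasGradHessOn S z Z H) (hT : T ⊆ S) : HasGradHessOn T z Z H :=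
  ⟨fun x hx => h.grad x (hT hx), fun x hx => h.hess x (hT hx)⟩

lemma add (h₁ : HasGradHessOn S z₁ Z₁ H₁) (h₂ : HasGradHessOn S z₂ Z₂ H₂) :
    HasGradHessOn S (fun x => z₁ x + z₂ x) (fun x => Z₁ x + Z₂ x) (fun x => H₁ x + H₂ x) := by
  refine ⟨fun x hx => ?_, fun x hx => (h₁.hess x hx).add (h₂.hess x hx)⟩
  rw [hasGradientAt_iff_hasFDerivAt, map_add]
  exact (h₁.grad x hx).hasFDerivAt.add (h₂.grad x hx).hasFDerivAt

lemma const_mul (h : HasGradHessOn S z Z H) (c : ℝ) :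
    HasGradHessOn S (fun x => c * z x) (fun x => c • Z x) (fun x => c • H x) := by
  refine ⟨fun x hx => ?_, fun x hx => (h.hess x hx).const_smul c⟩
  rw [hasGradientAt_iff_hasFDerivAt, map_smul]
  exact (h.grad x hx).hasFDerivAt.const_smul c

lemma comp_add (h : HasGradHessOn S z Z H) (a : E) (hT : ∀ x ∈ T, x + a ∈ S) :
    HasGradHessOn T (fun x => z (x + a)) (fun x => Z (x + a)) (fun x => H (x + a)) := by
  refine ⟨fun x hx => ?_, fun x hx => ?_⟩
  · rw [hasGradientAt_iff_hasFDerivAt]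
    exact (hasFDerivAt_comp_add_right a).2 (h.grad _ (hT x hx)).hasFDerivAt
  · exact (hasFDerivAt_comp_add_right a).2 (h.hess _ (hT x hx))

/-- Composition with a function of one variable. -/
lemma comp_real (h : HasGradHessOn S z Z H) {φ φ' φ'' : ℝ → ℝ}
    (h1 : ∀ x ∈ S, HasDerivAt φ (φ' (z x)) (z x))
    (h2 : ∀ x ∈ S, HasDerivAt φ' (φ'' (z x)) (z x)) :
    HasGradHessOn S (fun x => φ (z x)) (fun x => φ' (z x) • Z x)
      (fun x => φ' (z x) • H x +
        (φ'' (z x) • (innerSL ℝ (Z x))).smulRight (Z x)) := by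
  refine ⟨fun x hx => ?_, fun x hx => ?_⟩
  · rw [hasGradientAt_iff_hasFDerivAt, map_smul]
    exact (h1 x hx).comp_hasFDerivAt x (h.grad x hx).hasFDerivAt
  · have := ((h2 x hx).comp_hasFDerivAt x (h.grad x hx).hasFDerivAt).smul (h.hess x hx)
    exact this

lemma continuousOn (h : HasGradHessOn S z Z H) : ContinuousOn z S :=
  fun x hx => (h.grad x hx).continuousAt.continuousWithinAt

lemma continuousOn_grad (h : HasGradHessOn S z Z H) : ContinuousOn Z S :=
  fun x hx => (h.hess x hx).continuousAt.continuousWithinAt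

/-- Symmetry of second derivatives. -/
lemma symm (h : HasGradHessOn S z Z H) (hS : IsOpen S) {x : E} (hx : x ∈ S) (a b : E) :
    ⟪H x a, b⟫ = ⟪a, H x b⟫ := by
  have h1 : ∀ᶠ y in 𝓝 x, HasFDerivAt z (innerSL ℝ (Z y)) y := by
    filter_upwards [hS.mem_nhds hx] with y hy using (h.grad y hy).hasFDerivAt
  have h2 : HasFDerivAt (fun y => innerSL ℝ (Z y)) ((innerSL ℝ : E →L[ℝ] E →L[ℝ] ℝ).comp (H x)) x :=
    (innerSL ℝ : E →L[ℝ] E →L[ℝ] ℝ).hasFDerivAt.comp x (h.hess x hx)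
  have h3 := second_derivative_symmetric_of_eventually h1 h2 a b
  simp only [ContinuousLinearMap.comp_apply, innerSL_apply_apply] at h3
  rw [h3, real_inner_comm]

lemma line_grad (h : HasGradHessOn S z Z H) {x e : E} {t : ℝ} (hx : x + t • e ∈ S) :
    HasDerivAt (fun τ : ℝ => z (x + τ • e)) ⟪Z (x + t • e), e⟫ t := by
  have h1 : HasDerivAt (fun τ : ℝ => x + τ • e) e t := by
    simpa using ((hasDerivAt_id t).smul_const e).const_add x
  exact (h.grad _ hx).hasFDerivAt.comp_hasDerivAt t h1

lemma line_hess (h : HasGradHessOn S z Z H) {x e : E} {t : ℝ} (hx : x + t • e ∈ S) :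
    HasDerivAt (fun τ : ℝ => Z (x + τ • e)) (H (x + t • e) e) t := by
  have h1 : HasDerivAt (fun τ : ℝ => x + τ • e) e t := by
    simpa using ((hasDerivAt_id t).smul_const e).const_add x
  exact (h.hess _ hx).comp_hasDerivAt t h1

/-- A lower bound on the second derivative along a segment bounds the symmetric second difference
from below. -/
lemma le_secondDiff (h : HasGradHessOn S z Z H) {x e : E} {δ c : ℝ} (hδ : 0 ≤ δ)
    (hS : ∀ τ : ℝ, |τ| ≤ δ → x + τ • e ∈ S)
    (hc : ∀ τ : ℝ, |τ| ≤ δ → c ≤ ⟪H (x + τ • e) e, e⟫) :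
    c * δ ^ 2 ≤ z (x + δ • e) + z (x + (-δ) • e) - 2 * z x := by
  have habs : ∀ τ ∈ Icc (0 : ℝ) δ, |τ| ≤ δ ∧ |-τ| ≤ δ := fun τ hτ => by
    rw [abs_neg, abs_of_nonneg hτ.1]; exact ⟨hτ.2, hτ.2⟩
  have d1 : ∀ τ ∈ Icc (0 : ℝ) δ, HasDerivAt
      (fun τ => z (x + τ • e) + z (x + (-τ) • e) - c * τ ^ 2)
      (⟪Z (x + τ • e), e⟫ - ⟪Z (x + (-τ) • e), e⟫ - 2 * c * τ) τ := fun τ hτ => by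
    have a1 := h.line_grad (hS τ (habs τ hτ).1)
    have a2 := (h.line_grad (hS (-τ) (habs τ hτ).2)).scomp τ (hasDerivAt_neg τ)
    have a3 := ((hasDerivAt_id τ).pow 2).const_mul c
    refine ((a1.add a2).sub a3).congr_deriv ?_
    simp; ring
  have d2 : ∀ τ ∈ Icc (0 : ℝ) δ, HasDerivAt
      (fun τ => ⟪Z (x + τ • e), e⟫ - ⟪Z (x + (-τ) • e), e⟫ - 2 * c * τ)
      (⟪H (x + τ • e) e, e⟫ + ⟪H (x + (-τ) • e) e, e⟫ - 2 * c) τ := fun τ hτ => by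
    have a1 := (h.line_hess (hS τ (habs τ hτ).1)).inner ℝ (hasDerivAt_const τ e)
    have a2 := ((h.line_hess (hS (-τ) (habs τ hτ).2)).scomp τ (hasDerivAt_neg τ)).inner ℝ
      (hasDerivAt_const τ e)
    have a3 := (hasDerivAt_id τ).const_mul (2 * c)
    refine ((a1.sub a2).sub a3).congr_deriv ?_
    simp
  have hconv : Convex ℝ (Icc (0 : ℝ) δ) := convex_Icc 0 δ
  have m2 : MonotoneOn (fun τ : ℝ => ⟪Z (x + τ • e), e⟫ - ⟪Z (x + (-τ) • e), e⟫ - 2 * c * τ)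
      (Icc 0 δ) := by
    refine monotoneOn_of_deriv_nonneg hconv
      (fun τ hτ => (d2 τ hτ).continuousAt.continuousWithinAt)
      (fun τ hτ => (d2 τ (interior_subset hτ)).differentiableAt.differentiableWithinAt)
      fun τ hτ => ?_
    have hτ' := interior_subset hτ
    rw [(d2 τ hτ').deriv]
    linarith [hc τ (habs τ hτ').1, hc (-τ) (habs τ hτ').2]
  have m1 : MonotoneOn (fun τ : ℝ => z (x + τ • e) + z (x + (-τ) • e) - c * τ ^ 2)
      (Icc 0 δ) := by
    refine monotoneOn_of_deriv_nonneg hconv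
      (fun τ hτ => (d1 τ hτ).continuousAt.continuousWithinAt)
      (fun τ hτ => (d1 τ (interior_subset hτ)).differentiableAt.differentiableWithinAt)
      fun τ hτ => ?_
    have hτ' := interior_subset hτ
    rw [(d1 τ hτ').deriv]
    simpa using m2 (left_mem_Icc.2 hδ) hτ' hτ'.1
  have := m1 (left_mem_Icc.2 hδ) (right_mem_Icc.2 hδ) hδ
  simp only [neg_zero, zero_smul, add_zero, ne_eq, OfNat.ofNat_ne_zero, not_false_eq_true,
    zero_pow, mul_zero, sub_zero] at this
  linarith

lemma secondDiff_le (h : HasGradHessOn S z Z H) {x e : E} {δ c : ℝ} (hδ : 0 ≤ δ)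
    (hS : ∀ τ : ℝ, |τ| ≤ δ → x + τ • e ∈ S)
    (hc : ∀ τ : ℝ, |τ| ≤ δ → ⟪H (x + τ • e) e, e⟫ ≤ c) :
    z (x + δ • e) + z (x + (-δ) • e) - 2 * z x ≤ c * δ ^ 2 := by
  have := (h.const_mul (-1)).le_secondDiff (c := -c) hδ hS (fun τ hτ => by
    have := hc τ hτ
    simpa [inner_neg_left] using this)
  linarith

/-- The symmetric second difference of `z` along `e` with step `δ`, with its gradient and
Hessian. -/
lemma secondDiff (h : HasGradHessOn S z Z H) {e : E} {δ : ℝ} (hT : ∀ x ∈ T, x ∈ S)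
    (hT₁ : ∀ x ∈ T, x + δ • e ∈ S) (hT₂ : ∀ x ∈ T, x + (-δ) • e ∈ S) :
    HasGradHessOn T (fun x => z (x + δ • e) + z (x + (-δ) • e) + (-2) * z x)
      (fun x => Z (x + δ • e) + Z (x + (-δ) • e) + (-2 : ℝ) • Z x)
      (fun x => H (x + δ • e) + H (x + (-δ) • e) + (-2 : ℝ) • H x) :=
  ((h.comp_add _ hT₁).add (h.comp_add _ hT₂)).add ((h.mono hT).const_mul (-2))

/-- At an interior local maximum the second derivative is nonpositive in every direction. -/
lemma inner_nonpos_of_isLocalMax (h : HasGradHessOn S z Z H) (hS : IsOpen S) {x : E} (hx : x ∈ S)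
    (hmax : IsLocalMax z x) (e : E) : ⟪H x e, e⟫ ≤ 0 := by
  by_contra! hpos
  have hZ : Z x = 0 := by
    have := hmax.hasFDerivAt_eq_zero (h.grad x hx).hasFDerivAt
    simpa using this
  have hline : Tendsto (fun τ : ℝ => x + τ • e) (𝓝 0) (𝓝 x) := by
    have : Continuous fun τ : ℝ => x + τ • e := by fun_prop
    simpa using this.tendsto 0
  have hev : ∀ᶠ τ : ℝ in 𝓝 0, x + τ • e ∈ S := hline (hS.mem_nhds hx)
  have hd : ∀ᶠ τ : ℝ in 𝓝 0, deriv (fun τ : ℝ => z (x + τ • e)) τ = ⟪Z (x + τ • e), e⟫ := by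
    filter_upwards [hev] with τ hτ using (h.line_grad hτ).deriv
  have hdd : deriv (deriv fun τ : ℝ => z (x + τ • e)) 0 = ⟪H x e, e⟫ := by
    rw [Filter.EventuallyEq.deriv_eq hd]
    have h0 : x + (0 : ℝ) • e ∈ S := by simpa using hx
    have := ((h.line_hess h0).inner ℝ (hasDerivAt_const (0 : ℝ) e)).deriv
    simpa using this
  have h0 : x + (0 : ℝ) • e ∈ S := by simpa using hx
  have hmin : IsLocalMin (fun τ : ℝ => z (x + τ • e)) 0 := by
    refine isLocalMin_of_deriv_deriv_pos (by rw [hdd]; exact hpos) ?_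
      (h.line_grad h0).continuousAt
    rw [(h.line_grad h0).deriv]; simp [hZ]
  have hmax' : ∀ᶠ τ : ℝ in 𝓝 0, z (x + τ • e) ≤ z x := hline hmax
  have hconst : (fun τ : ℝ => z (x + τ • e)) =ᶠ[𝓝 0] fun _ => z x := by
    filter_upwards [hmin, hmax'] with τ h1 h2
    simp only [zero_smul, add_zero] at h1
    exact le_antisymm h2 h1
  have : deriv (deriv fun τ : ℝ => z (x + τ • e)) 0 = 0 := by
    rw [hconst.deriv.deriv_eq]; simp
  rw [hdd] at this
  exact hpos.ne' this

/-- Weak maximum principle: a function with positive Laplacian on an open subset `S` of a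
compact set `K` attains its maximum over `K` off `S`. -/
lemma exists_le_of_trace_pos (h : HasGradHessOn S z Z H) (hS : IsOpen S) {K : Set E}
    (hK : IsCompact K) (hSK : S ⊆ K) (hz : ContinuousOn z K)
    (hpos : ∀ x ∈ S, 0 < LinearMap.trace ℝ E (H x)) {x : E} (hx : x ∈ K) :
    ∃ y ∈ K \ S, z x ≤ z y := by
  obtain ⟨y, hyK, hy⟩ := hK.exists_isMaxOn ⟨x, hx⟩ hz
  refine ⟨y, ⟨hyK, fun hyS => ?_⟩, hy hx⟩
  have hmax : IsLocalMax z y := by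
    filter_upwards [hS.mem_nhds hyS] with a ha using hy (hSK ha)
  have := hpos y hyS
  rw [LinearMap.trace_eq_sum_inner _ (stdOrthonormalBasis ℝ E)] at this
  refine absurd this (not_lt.2 (Finset.sum_nonpos fun i _ => ?_))
  rw [real_inner_comm]
  exact h.inner_nonpos_of_isLocalMax hS hyS hmax _

end HasGradHessOn

lemma trace_smulRight (a b : E) :
    LinearMap.trace ℝ E ((innerSL ℝ a).smulRight b : E →L[ℝ] E) = ⟪a, b⟫ := by
  rw [LinearMap.trace_eq_sum_inner _ (stdOrthonormalBasis ℝ E)]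
  simp only [ContinuousLinearMap.coe_coe, ContinuousLinearMap.smulRight_apply,
    innerSL_apply_apply, inner_smul_right]
  exact (stdOrthonormalBasis ℝ E).sum_inner_mul_inner a b

/-- Half the squared distance to a point has Hessian the identity. -/
lemma hasGradHessOn_half_norm_sq (a : E) :
    HasGradHessOn univ (fun x => ‖x - a‖ ^ 2 / 2) (fun x => x - a)
      (fun _ => ContinuousLinearMap.id ℝ E) := by
  refine ⟨fun x _ => ?_, fun x _ => (hasFDerivAt_id x).sub_const a⟩
  rw [hasGradientAt_iff_hasFDerivAt]
  have h1 := (((hasFDerivAt_id x).sub_const a).norm_sq).const_mul (1 / 2)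
  have h2 : (fun y : E => 1 / 2 * ‖id y - a‖ ^ 2) = fun y => ‖y - a‖ ^ 2 / 2 := by
    funext y; simp only [id]; ring
  rw [h2] at h1
  refine h1.congr_fderiv ?_
  ext y; simp

lemma trace_id : LinearMap.trace ℝ E (ContinuousLinearMap.id ℝ E : E →L[ℝ] E) =
    Module.finrank ℝ E := by
  exact LinearMap.trace_id ℝ E

end

/-! ### Recovering a multiset from its logarithmic derivatives -/

section

variable {E : Type*} [NormedAddCommGroup E] [InnerProductSpace ℝ E]

lemma hasDerivAt_prod_one_add {ι : Type*} [Fintype ι] (l : ι → ℝ) {c : ℝ}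
    (hc : ∀ i, 1 + c * l i ≠ 0) :
    HasDerivAt (fun c => ∏ i, (1 + c * l i))
      ((∏ i, (1 + c * l i)) * ∑ i, l i / (1 + c * l i)) c := by
  classical
  have h1 : ∀ i ∈ (Finset.univ : Finset ι), HasDerivAt (fun c => 1 + c * l i) (l i) c :=
    fun i _ => by simpa using ((hasDerivAt_id c).mul_const (l i)).const_add 1
  refine (HasDerivAt.fun_finsetProd h1).congr_deriv ?_
  rw [Finset.mul_sum]
  refine Finset.sum_congr rfl fun i hi => ?_
  rw [← Finset.mul_prod_erase _ _ hi, smul_eq_mul]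
  field_simp [hc i]

/-- The function `c ↦ ∑ lᵢ / (1 + c lᵢ)` near `0` is the logarithmic derivative of
`∏ (1 + c lᵢ)` and hence determines the multiset of the `lᵢ`. -/
lemma map_eq_map_of_sum_div_eq {ι : Type*} [Fintype ι] {l l' : ι → ℝ} {ε : ℝ} (hε : 0 < ε)
    (h1 : ∀ c : ℝ, |c| < ε → ∀ i, 1 + c * l i ≠ 0)
    (h2 : ∀ c : ℝ, |c| < ε → ∀ i, 1 + c * l' i ≠ 0)
    (h : ∀ c : ℝ, |c| < ε → ∑ i, l i / (1 + c * l i) = ∑ i, l' i / (1 + c * l' i)) :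
    Finset.univ.val.map l = Finset.univ.val.map l' := by
  have key : ∀ c : ℝ, |c| < ε → ∏ i, (1 + c * l i) = ∏ i, (1 + c * l' i) := by
    intro c hc
    have hd : ∀ c ∈ Ioo (-ε) ε, HasDerivAt
        (fun c => (∏ i, (1 + c * l i)) / ∏ i, (1 + c * l' i)) 0 c := by
      intro c hc
      have hc' : |c| < ε := abs_lt.2 hc
      refine ((hasDerivAt_prod_one_add l (h1 c hc')).div (hasDerivAt_prod_one_add l' (h2 c hc'))
        (Finset.prod_ne_zero_iff.2 fun i _ => h2 c hc' i)).congr_deriv ?_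
      rw [h c hc']; ring
    have := isOpen_Ioo.is_const_of_deriv_eq_zero isPreconnected_Ioo
      (fun c hc => (hd c hc).differentiableAt.differentiableWithinAt)
      (fun c hc => (hd c hc).deriv) (abs_lt.1 hc) (show (0 : ℝ) ∈ Ioo (-ε) ε by simp [hε])
    simp only [zero_mul, add_zero, Finset.prod_const_one, div_one] at this
    exact (div_eq_one_iff_eq (Finset.prod_ne_zero_iff.2 fun i _ => h2 c hc i)).1 this
  have hpoly : ((Finset.univ.val.map l).map fun a => Polynomial.X - Polynomial.C a).prod =
      ((Finset.univ.val.map l').map fun a => Polynomial.X - Polynomial.C a).prod := by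
    refine Polynomial.eq_of_infinite_eval_eq _ _ ((Ioi_infinite (1 / ε)).mono fun y hy => ?_)
    have hy0 : 0 < y := lt_trans (by positivity) hy
    have hyε : |(-1 / y)| < ε := by
      rw [abs_div, abs_neg, abs_one, abs_of_pos hy0, one_div_lt hy0 hε]
      exact hy
    have hk := key _ hyε
    have e : ∀ m : ι → ℝ, ∏ i, (y - m i) = y ^ Fintype.card ι * ∏ i, (1 + (-1 / y) * m i) := by
      intro m
      rw [← Finset.card_univ, ← Finset.prod_const, ← Finset.prod_mul_distrib]
      refine Finset.prod_congr rfl fun i _ => ?_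
      field_simp; ring
    simp only [mem_ofPred_eq, Multiset.map_map, Function.comp_def]
    change Polynomial.eval y (∏ i, (Polynomial.X - Polynomial.C (l i))) =
      Polynomial.eval y (∏ i, (Polynomial.X - Polynomial.C (l' i)))
    simp only [Polynomial.eval_prod, Polynomial.eval_sub, Polynomial.eval_X, Polynomial.eval_C]
    rw [e, e, hk]
  rw [← Polynomial.roots_multiset_prod_X_sub_C (Finset.univ.val.map l), hpoly,
    Polynomial.roots_multiset_prod_X_sub_C]

/-! ### Eigenbases -/

/-- The orthonormal basis `b` consists of eigenvectors of `T`, with eigenvalues `l`. -/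
def IsEigenbasis {ι : Type*} [Fintype ι] (T : E →L[ℝ] E) (b : OrthonormalBasis ι ℝ E)
    (l : ι → ℝ) : Prop :=
  ∀ i, T (b i) = l i • b i

namespace IsEigenbasis

variable {ι : Type*} [Fintype ι] {T : E →L[ℝ] E} {b : OrthonormalBasis ι ℝ E} {l : ι → ℝ}

lemma trace_eq (h : IsEigenbasis T b l) : LinearMap.trace ℝ E T = ∑ i, l i := by
  rw [LinearMap.trace_eq_sum_inner _ b]
  refine Finset.sum_congr rfl fun i _ => ?_
  rw [ContinuousLinearMap.coe_coe, h i, inner_smul_right]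
  simp

lemma inner_apply (h : IsEigenbasis T b l) (e : E) (i : ι) : ⟪b i, T e⟫ = l i * ⟪b i, e⟫ := by
  have h1 : T e = ∑ j, (l j * ⟪b j, e⟫) • b j := by
    conv_lhs => rw [← b.sum_repr' e]
    rw [map_sum]
    refine Finset.sum_congr rfl fun j _ => ?_
    rw [map_smul, h j, smul_smul, mul_comm]
  rw [h1, b.orthonormal.inner_right_fintype]

lemma inner_apply_self (h : IsEigenbasis T b l) (e : E) :
    ⟪T e, e⟫ = ∑ i, l i * ⟪b i, e⟫ ^ 2 := by
  rw [← b.sum_inner_mul_inner]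
  refine Finset.sum_congr rfl fun i _ => ?_
  rw [real_inner_comm, h.inner_apply]; ring

lemma apply_apply_of_sq_eq (h : IsEigenbasis T b l) {c : ℝ} (hl : ∀ i, l i * l i = c * l i)
    (e : E) : T (T e) = c • T e := by
  refine InnerProductSpace.ext_inner_left_basis b.toBasis fun i => ?_
  simp only [OrthonormalBasis.coe_toBasis]
  rw [h.inner_apply, inner_smul_right, h.inner_apply, ← mul_assoc, hl, mul_assoc]

lemma eq_zero (h : IsEigenbasis T b l) (hl : ∀ i, l i = 0) : T = 0 := by
  ext1 e
  refine InnerProductSpace.ext_inner_left_basis b.toBasis fun i => ?_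
  simp [h.inner_apply, hl]

lemma eq_zero_of_trace (h : IsEigenbasis T b l) (hl : ∀ i j, l i ≠ 0 → l j ≠ 0 → l i = l j)
    (ht : LinearMap.trace ℝ E T = 0) : T = 0 := by
  refine h.eq_zero fun i => by_contra fun hi => ?_
  have h1 : ∀ j, l j = 0 ∨ l j = l i := fun j => by
    by_cases hj : l j = 0
    · exact Or.inl hj
    · exact Or.inr (hl j i hj hi)
  have h2 : ∑ j, l i * l j = 0 := by rw [← Finset.mul_sum, ← h.trace_eq, ht, mul_zero]
  have h3 := (Finset.sum_eq_zero_iff_of_nonneg (s := Finset.univ) (f := fun j => l i * l j)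
    fun j _ => by
      rcases h1 j with h | h
      · simp [h]
      · rw [h]; exact mul_self_nonneg _).1 h2 i (Finset.mem_univ i)
  exact hi (mul_self_eq_zero.1 h3)

end IsEigenbasis

variable [FiniteDimensional ℝ E]

lemma exists_isEigenbasis {T : E →L[ℝ] E} (hT : ∀ a b, ⟪T a, b⟫ = ⟪a, T b⟫) :
    ∃ (b : OrthonormalBasis (Fin (Module.finrank ℝ E)) ℝ E) (l : Fin (Module.finrank ℝ E) → ℝ),
      IsEigenbasis T b l := by
  have hs : (T : E →ₗ[ℝ] E).IsSymmetric := fun a b => hT a b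
  exact ⟨hs.eigenvectorBasis rfl, hs.eigenvalues rfl, fun i => hs.apply_eigenvectorBasis rfl i⟩

/-! ### Isoparametric distance functions -/

/-- On the open set `S`, the function `w` is of class `C²` with gradient `N` and Hessian `A`, it
solves the eikonal equation `|∇w| = 1`, and its Laplacian is the function `h` of `w`. -/
structure IsoDist (S : Set E) (w : E → ℝ) (N : E → E) (A : E → E →L[ℝ] E) (h : ℝ → ℝ) : Prop
    extends HasGradHessOn S w N A where
  isOpen : IsOpen S
  norm_grad : ∀ x ∈ S, ‖N x‖ = 1
  continuousOn_hess : ContinuousOn A S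
  trace_hess : ∀ x ∈ S, LinearMap.trace ℝ E (A x) = h (w x)

namespace IsoDist

variable {S : Set E} {w : E → ℝ} {N : E → E} {A : E → E →L[ℝ] E} {h : ℝ → ℝ}

lemma inner_hess_comm (H : IsoDist S w N A h) {x : E} (hx : x ∈ S) (a b : E) :
    ⟪A x a, b⟫ = ⟪a, A x b⟫ :=
  H.symm H.isOpen hx a b

lemma hess_grad (H : IsoDist S w N A h) {x : E} (hx : x ∈ S) : A x (N x) = 0 := by
  refine ext_inner_left ℝ fun a => ?_
  rw [← H.inner_hess_comm hx, inner_zero_right]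
  have h1 := (H.hess x hx).norm_sq
  have h2 : (fun y => ‖N y‖ ^ 2) =ᶠ[𝓝 x] fun _ => 1 := by
    filter_upwards [H.isOpen.mem_nhds hx] with y hy
    rw [H.norm_grad y hy, one_pow]
  have h3 := h1.unique ((hasFDerivAt_const (1 : ℝ) x).congr_of_eventuallyEq h2)
  have h4 := DFunLike.congr_fun h3 a
  simp only [_root_.smul_apply, ContinuousLinearMap.comp_apply, innerSL_apply_apply,
    _root_.zero_apply, nsmul_eq_mul] at h4
  rw [real_inner_comm]
  simpa using h4

/-- The gradient is constant along the normal lines. -/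
lemma grad_line (H : IsoDist S w N A h) {x : E} {r c : ℝ} (hr : ball x r ⊆ S) (hc : |c| < r) :
    N (x + c • N x) = N x := by
  have hr0 : 0 < r := (abs_nonneg c).trans_lt hc
  have hx : x ∈ S := hr (mem_ball_self hr0)
  have hseg : ∀ τ ∈ Icc (0 : ℝ) 1, x + τ • c • N x ∈ S := fun τ hτ => by
    refine hr ?_
    rw [mem_ball, dist_eq_norm, add_sub_cancel_left, norm_smul, norm_smul, H.norm_grad x hx,
      mul_one, Real.norm_eq_abs, Real.norm_eq_abs, abs_of_nonneg hτ.1]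
    exact (mul_le_of_le_one_left (abs_nonneg c) hτ.2).trans_lt hc
  have hcont : ContinuousOn (fun τ : ℝ => A (x + τ • c • N x)) (Icc 0 1) :=
    H.continuousOn_hess.comp (by fun_prop) hseg
  obtain ⟨K, hK⟩ := isCompact_Icc.exists_bound_of_continuousOn hcont
  have hd : ∀ τ ∈ Icc (0 : ℝ) 1, HasDerivAt (fun τ : ℝ => N (x + τ • c • N x) - N x)
      (A (x + τ • c • N x) (c • N x)) τ := fun τ hτ =>
    (H.line_hess (hseg τ hτ)).sub_const _
  have := eq_zero_of_abs_deriv_le_mul_abs_self_of_eq_zero_right (K := K * |c|) (a := 0) (b := 1)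
    (fun τ hτ => (hd τ hτ).continuousAt.continuousWithinAt)
    (fun τ hτ => (hd τ (Ico_subset_Icc_self hτ)).hasDerivWithinAt) (by simp)
    (fun τ hτ => by
      have hτ' := Ico_subset_Icc_self hτ
      -- since `A N = 0`, the vector `N x` may be replaced by minus the difference
      have e : A (x + τ • c • N x) (c • N x) =
          -(c • A (x + τ • c • N x) (N (x + τ • c • N x) - N x)) := by
        rw [map_sub, H.hess_grad (hseg τ hτ'), map_smul]; simp
      rw [e, norm_neg, norm_smul, Real.norm_eq_abs]
      calc |c| * ‖A (x + τ • c • N x) (N (x + τ • c • N x) - N x)‖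
          ≤ |c| * (K * ‖N (x + τ • c • N x) - N x‖) := by
            gcongr
            exact (A _).le_of_opNorm_le (hK τ hτ') _
        _ = K * |c| * ‖N (x + τ • c • N x) - N x‖ := by ring) 1 (by simp)
  simpa [sub_eq_zero] using this

lemma line_mem (H : IsoDist S w N A h) {x : E} {r c : ℝ} (hr : ball x r ⊆ S) (hc : |c| < r) :
    x + c • N x ∈ S := by
  have hx : x ∈ S := hr (mem_ball_self ((abs_nonneg c).trans_lt hc))
  refine hr ?_
  rwa [mem_ball, dist_eq_norm, add_sub_cancel_left, norm_smul, H.norm_grad x hx, mul_one]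

/-- Along a normal line `w` is the arc length. -/
lemma apply_line (H : IsoDist S w N A h) {x : E} {r c : ℝ} (hr : ball x r ⊆ S) (hc : |c| < r) :
    w (x + c • N x) = w x + c := by
  have hr0 : 0 < r := (abs_nonneg c).trans_lt hc
  have hx : x ∈ S := hr (mem_ball_self hr0)
  have hd : ∀ τ ∈ Ioo (-r) r, HasDerivAt (fun τ : ℝ => w (x + τ • N x) - τ) 0 τ := fun τ hτ => by
    have h1 := (H.line_grad (H.line_mem hr (abs_lt.2 hτ))).sub (hasDerivAt_id τ)
    rw [H.grad_line hr (abs_lt.2 hτ), real_inner_self_eq_norm_sq, H.norm_grad x hx] at h1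
    exact h1.congr_deriv (by simp)
  have := isOpen_Ioo.is_const_of_deriv_eq_zero isPreconnected_Ioo
    (fun c hc => (hd c hc).differentiableAt.differentiableWithinAt)
    (fun c hc => (hd c hc).deriv) (abs_lt.1 hc) (show (0 : ℝ) ∈ Ioo (-r) r by simp [hr0])
  simp only [zero_smul, add_zero, sub_zero] at this
  linarith

/-- The Hessian along a normal line, obtained by differentiating the constancy of the gradient
with respect to the foot point; no third derivatives of `w` are involved. -/
lemma hess_line (H : IsoDist S w N A h) {x : E} {r c : ℝ} (hr : ball x r ⊆ S) (hc : |c| < r)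
    (a : E) : A (x + c • N x) (a + c • A x a) = A x a := by
  have hr0 : 0 < r := (abs_nonneg c).trans_lt hc
  have hx : x ∈ S := hr (mem_ball_self hr0)
  have h1 : HasFDerivAt (fun y => y + c • N y) (ContinuousLinearMap.id ℝ E + c • A x) x :=
    (hasFDerivAt_id x).add ((H.hess x hx).const_smul c)
  have h2 : HasFDerivAt (fun y => N (y + c • N y)) _ x :=
    (H.hess _ (H.line_mem hr hc)).comp x h1
  have h3 : (fun y => N (y + c • N y)) =ᶠ[𝓝 x] N := by
    filter_upwards [ball_mem_nhds x (sub_pos.2 hc)] with y hy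
    refine H.grad_line (r := r - dist y x) ((ball_subset_ball' (by linarith)).trans hr) ?_
    rw [mem_ball] at hy; linarith
  have h4 := h2.unique ((H.hess x hx).congr_of_eventuallyEq h3)
  simpa using DFunLike.congr_fun h4 a

variable {ι : Type*} [Fintype ι] {b b₀ : OrthonormalBasis ι ℝ E} {l l₀ : ι → ℝ}

lemma one_add_mul_ne_zero (H : IsoDist S w N A h) {x : E} {r c : ℝ} (hr : ball x r ⊆ S)
    (hc : |c| < r) (hb : IsEigenbasis (A x) b l) (i : ι) : 1 + c * l i ≠ 0 := by
  intro h0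
  have h1 := H.hess_line hr hc (b i)
  rw [hb i, smul_smul, ← one_smul ℝ (b i), smul_smul, mul_one, ← add_smul, h0, zero_smul,
    map_zero] at h1
  rcases smul_eq_zero.1 h1.symm with h2 | h2
  · rw [h2] at h0; simp at h0
  · exact b.orthonormal.ne_zero i (by simpa using h2)

lemma isEigenbasis_line (H : IsoDist S w N A h) {x : E} {r c : ℝ} (hr : ball x r ⊆ S)
    (hc : |c| < r) (hb : IsEigenbasis (A x) b l) :
    IsEigenbasis (A (x + c • N x)) b fun i => l i / (1 + c * l i) := fun i => by
  have h0 := H.one_add_mul_ne_zero hr hc hb i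
  have h1 := H.hess_line hr hc (b i)
  have h2 : b i + c • A x (b i) = (1 + c * l i) • b i := by
    rw [hb i, add_smul, one_smul, mul_smul]
  rw [h2, map_smul, hb i] at h1
  simp only [div_eq_inv_mul]
  rw [mul_smul, ← h1, inv_smul_smul₀ h0]

lemma laplacian_line (H : IsoDist S w N A h) {x : E} {r c : ℝ} (hr : ball x r ⊆ S)
    (hc : |c| < r) (hb : IsEigenbasis (A x) b l) :
    h (w x + c) = ∑ i, l i / (1 + c * l i) := by
  rw [← H.apply_line hr hc, ← H.trace_hess _ (H.line_mem hr hc),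
    (H.isEigenbasis_line hr hc hb).trace_eq]

lemma eventually_abs_sub_lt (H : IsoDist S w N A h) {x₀ : E} (hx₀ : x₀ ∈ S) {ε : ℝ} (hε : 0 < ε) :
    ∀ᶠ x in 𝓝 x₀, |w x - w x₀| < ε := by
  have := (H.grad x₀ hx₀).continuousAt
  filter_upwards [this (ball_mem_nhds (w x₀) hε)] with x hx
  simpa [Real.dist_eq] using hx

/-- Near `x₀` the eigenvalues of the Hessian of `w`, with multiplicities, depend on the value of
`w` only, and they evolve like the principal curvatures of parallel hypersurfaces. -/
lemma eventually_eigenvalues (H : IsoDist S w N A h) {x₀ : E} (hx₀ : x₀ ∈ S)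
    (hb₀ : IsEigenbasis (A x₀) b₀ l₀) :
    ∀ᶠ x in 𝓝 x₀, x ∈ S ∧ (∀ i, 1 + (w x - w x₀) * l₀ i ≠ 0) ∧
      ∀ (b : OrthonormalBasis ι ℝ E) (l : ι → ℝ), IsEigenbasis (A x) b l →
        Finset.univ.val.map l =
          Finset.univ.val.map fun i => l₀ i / (1 + (w x - w x₀) * l₀ i) := by
  obtain ⟨r, hr0, hr⟩ := Metric.isOpen_iff.1 H.isOpen x₀ hx₀
  filter_upwards [H.eventually_abs_sub_lt hx₀ (half_pos hr0), ball_mem_nhds x₀ (half_pos hr0)]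
    with x hx hxb
  have hrx : ball x (r / 2) ⊆ S :=
    (ball_subset_ball' (by rw [mem_ball] at hxb; linarith)).trans hr
  have ht : |w x - w x₀| < r := hx.trans (half_lt_self hr0)
  have hne := H.one_add_mul_ne_zero hr ht hb₀
  have hsum : ∀ c : ℝ, |c| < r / 2 → |w x - w x₀ + c| < r := fun c hc =>
    (abs_add_le _ _).trans_lt (by linarith)
  have hfrac : ∀ c : ℝ, ∀ i, (1 + (w x - w x₀ + c) * l₀ i) = (1 + (w x - w x₀) * l₀ i) *
      (1 + c * (l₀ i / (1 + (w x - w x₀) * l₀ i))) := fun c i => by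
    field_simp [hne i]; ring
  refine ⟨hrx (mem_ball_self (half_pos hr0)), hne, fun b l hb => ?_⟩
  refine map_eq_map_of_sum_div_eq (half_pos hr0)
    (fun c hc i => H.one_add_mul_ne_zero hrx hc hb i) (fun c hc i h0 => ?_) fun c hc => ?_
  · refine H.one_add_mul_ne_zero hr (hsum c hc) hb₀ i ?_
    rw [hfrac, h0, mul_zero]
  · rw [← H.laplacian_line hrx hc hb, show w x + c = w x₀ + (w x - w x₀ + c) by ring,
      H.laplacian_line hr (hsum c hc) hb₀]
    refine Finset.sum_congr rfl fun i _ => ?_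
    rw [hfrac, div_div]

end IsoDist

end

/-! ### Maximum principles for second derivatives -/

section

variable {E : Type*} [NormedAddCommGroup E] [InnerProductSpace ℝ E]

lemma add_smul_mem_ball {x y e : E} {τ δ r R : ℝ} (he : ‖e‖ = 1) (hx : dist x y ≤ r)
    (hτ : |τ| ≤ δ) (hR : r + δ < R) : x + τ • e ∈ ball y R := by
  rw [mem_ball]
  have h1 : dist (x + τ • e) x = |τ| := by
    rw [dist_eq_norm, add_sub_cancel_left, norm_smul, he, mul_one, Real.norm_eq_abs]
  linarith [dist_triangle (x + τ • e) x y]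

lemma trace_secondDiff (a b c : E →L[ℝ] E) :
    LinearMap.trace ℝ E (a + b + (-2 : ℝ) • c : E →L[ℝ] E) =
      LinearMap.trace ℝ E a + LinearMap.trace ℝ E b - 2 * LinearMap.trace ℝ E c := by
  have : ((a + b + (-2 : ℝ) • c : E →L[ℝ] E) : E →ₗ[ℝ] E) =
    (a : E →ₗ[ℝ] E) + (b : E →ₗ[ℝ] E) + (-2 : ℝ) • (c : E →ₗ[ℝ] E) := rfl
  rw [this, map_add, map_add, map_smul, smul_eq_mul]; ring

variable [FiniteDimensional ℝ E]

/-- The Hessian of the barrier `exp (-α ‖x - a‖² / 2)` used in the Hopf lemma. -/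
lemma hasGradHessOn_exp (a : E) (α : ℝ) :
    ∃ (Z : E → E) (K : E → E →L[ℝ] E),
      HasGradHessOn univ (fun x => Real.exp (-α * (‖x - a‖ ^ 2 / 2))) Z K ∧
      ∀ x, LinearMap.trace ℝ E (K x) = Real.exp (-α * (‖x - a‖ ^ 2 / 2)) *
        (α * (α * ‖x - a‖ ^ 2 - Module.finrank ℝ E)) := by
  have h1 : ∀ y : ℝ, HasDerivAt (fun y => Real.exp (-α * y)) (-α * Real.exp (-α * y)) y :=
    fun y => by
      have := ((hasDerivAt_id y).const_mul (-α)).exp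
      simpa [mul_comm] using this
  refine ⟨_, _, (hasGradHessOn_half_norm_sq a).comp_real
    (φ := fun y => Real.exp (-α * y)) (φ' := fun y => -α * Real.exp (-α * y))
    (φ'' := fun y => -α * (-α * Real.exp (-α * y))) (fun x _ => h1 _)
    (fun x _ => (h1 _).const_mul (-α)), fun x => ?_⟩
  rw [ContinuousLinearMap.toLinearMap_add, map_add, ContinuousLinearMap.toLinearMap_smul,
    map_smul, trace_id,
    ← map_smul, trace_smulRight, inner_smul_left, real_inner_self_eq_norm_sq]
  simp only [smul_eq_mul, conj_trivial]
  ring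

namespace HasGradHessOn

variable {v g : E → ℝ} {V Z : E → E} {H K : E → E →L[ℝ] E} {x₀ e : E} {ρ c k : ℝ}

/-- If the pure second derivative of `v` in the direction `e` attains its maximum at `x₀`, then
the pure second derivative of the Laplacian `g` of `v` is not positive there. As `v` is only of
class `C²`, second difference quotients of `v` take the role of the second derivative. -/
lemma not_pos_of_max (hv : HasGradHessOn (ball x₀ (2 * ρ)) v V H) (hρ : 0 < ρ)
    (hg : HasGradHessOn (ball x₀ (2 * ρ)) g Z K) (he : ‖e‖ = 1)
    (hH : ContinuousOn H (ball x₀ (2 * ρ)))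
    (htr : ∀ x ∈ ball x₀ (2 * ρ), LinearMap.trace ℝ E (H x) = g x)
    (hle : ∀ x ∈ ball x₀ (2 * ρ), ⟪H x e, e⟫ ≤ 1) (heq : ⟪H x₀ e, e⟫ = 1) (hc : 0 < c)
    (hK : ∀ x ∈ ball x₀ (2 * ρ), c ≤ ⟪K x e, e⟫) : False := by
  set n : ℝ := (Module.finrank ℝ E : ℝ) with hn
  have hn0 : 0 ≤ n := Nat.cast_nonneg _
  set κ : ℝ := c / (n + 1) with hκ
  have hκ0 : 0 < κ := by positivity
  have hκn : κ * n < c := by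
    rw [hκ, div_mul_eq_mul_div, div_lt_iff₀ (by linarith)]; nlinarith
  -- a step `δ` so small that the second difference quotient at `x₀` is close to `1`
  have hcont : ContinuousAt (fun x => ⟪H x e, e⟫) x₀ := by
    have := hH.continuousAt (ball_mem_nhds x₀ (by linarith : 0 < 2 * ρ))
    fun_prop
  obtain ⟨δ', hδ', hδ'H⟩ := Metric.eventually_nhds_iff_ball.1
    (hcont.eventually (lt_mem_nhds (show 1 - κ * ρ ^ 2 / 4 < ⟪H x₀ e, e⟫ by
      rw [heq]; have : 0 < κ * ρ ^ 2 := by positivity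
      linarith)))
  obtain ⟨δ, hδ0, hδ⟩ := exists_between (lt_min hδ' hρ)
  have hδ1 : δ < δ' := hδ.trans_le (min_le_left _ _)
  have hδ2 : δ < ρ := hδ.trans_le (min_le_right _ _)
  have hmem : ∀ x ∈ closedBall x₀ ρ, ∀ τ : ℝ, |τ| ≤ δ → x + τ • e ∈ ball x₀ (2 * ρ) :=
    fun x hx τ hτ => add_smul_mem_ball he hx hτ (by linarith)
  have hδabs : |δ| ≤ δ := (abs_of_pos hδ0).le
  have hδabs' : |-δ| ≤ δ := by rw [abs_neg]; exact hδabs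
  have hsub : closedBall x₀ ρ ⊆ ball x₀ (2 * ρ) := closedBall_subset_ball (by linarith)
  have hz := (hv.secondDiff (T := closedBall x₀ ρ) (e := e) (δ := δ) (fun x hx => hsub hx)
    (fun x hx => hmem x hx δ hδabs) (fun x hx => hmem x hx (-δ) hδabs')).add
    (((hasGradHessOn_half_norm_sq x₀).mono (subset_univ _)).const_mul (-(κ * δ ^ 2)))
  obtain ⟨y, ⟨hyK, hyU⟩, hy⟩ := (hz.mono ball_subset_closedBall).exists_le_of_trace_pos isOpen_ball
    (isCompact_closedBall x₀ ρ) ball_subset_closedBall hz.continuousOn (fun x hx => by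
      have hx' := ball_subset_closedBall hx
      have h1 := hg.le_secondDiff hδ0.le (hmem x hx') fun τ hτ => hK _ (hmem x hx' τ hτ)
      rw [ContinuousLinearMap.toLinearMap_add, map_add, trace_secondDiff,
        ContinuousLinearMap.toLinearMap_smul, map_smul, trace_id, htr _ (hmem x hx' δ hδabs),
        htr _ (hmem x hx' (-δ) hδabs'),
        htr _ (hsub hx'), smul_eq_mul]
      have : 0 < (c - κ * n) * δ ^ 2 := mul_pos (by linarith) (by positivity)
      linarith) (mem_closedBall_self hρ.le)
  have hyρ : ‖y - x₀‖ = ρ := by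
    rw [← dist_eq_norm]
    exact le_antisymm hyK (not_lt.1 hyU)
  have h1 := hv.secondDiff_le hδ0.le (hmem y hyK) fun τ hτ => hle _ (hmem y hyK τ hτ)
  have h2 := hv.le_secondDiff hδ0.le (hmem x₀ (mem_closedBall_self hρ.le)) fun τ hτ =>
    (hδ'H (x₀ + τ • e) (add_smul_mem_ball he (dist_self x₀).le hτ (by linarith))).le
  simp only [hyρ, sub_self, norm_zero] at hy
  have : 0 < κ * ρ ^ 2 * δ ^ 2 := by positivity
  linarith

/-- A strong maximum principle: if `v` has constant Laplacian and its pure second derivative in the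
direction `e` attains its maximum at `x₀`, then this second derivative is constant near `x₀`. The
second difference quotients of `v` are harmonic, and comparison with a barrier on an annulus gives a
lower bound for their deficit at `x₀` which does not depend on the step. -/
lemma eq_one_of_max (hv : HasGradHessOn (ball x₀ ρ) v V H) (hρ : 0 < ρ) (he : ‖e‖ = 1)
    (hH : ContinuousOn H (ball x₀ ρ))
    (htr : ∀ x ∈ ball x₀ ρ, LinearMap.trace ℝ E (H x) = k)
    (hle : ∀ x ∈ ball x₀ ρ, ⟪H x e, e⟫ ≤ 1) (heq : ⟪H x₀ e, e⟫ = 1)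
    {x₁ : E} (hx₁ : x₁ ∈ ball x₀ (ρ / 8)) : ⟪H x₁ e, e⟫ = 1 := by
  by_contra hne
  have hlt : ⟪H x₁ e, e⟫ < 1 := lt_of_le_of_ne (hle x₁ (ball_subset_ball (by linarith) hx₁)) hne
  obtain ⟨η', hη1, hη2⟩ := exists_between hlt
  have hcont : ∀ x ∈ ball x₀ ρ, ContinuousAt (fun x => ⟪H x e, e⟫) x := fun x hx => by
    have := hH.continuousAt (isOpen_ball.mem_nhds hx)
    fun_prop
  obtain ⟨r', hr', hr'H⟩ := Metric.eventually_nhds_iff_ball.1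
    ((hcont x₁ (ball_subset_ball (by linarith) hx₁)).eventually (gt_mem_nhds hη1))
  obtain ⟨η, rfl⟩ : ∃ η, η' = 1 - η := ⟨1 - η', by ring⟩
  have hη : 0 < η := by linarith
  obtain ⟨r, hr0, hr⟩ : ∃ r, 0 < r ∧ r < min (r' / 2) (ρ / 8) :=
    exists_between (lt_min (by linarith) (by linarith))
  have hrr' : r < r' / 2 := hr.trans_le (min_le_left _ _)
  have hrρ : r < ρ / 8 := hr.trans_le (min_le_right _ _)
  rw [mem_ball, dist_comm] at hx₁
  have hx₀r : r ≤ dist x₀ x₁ := by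
    by_contra! hcon
    have := hr'H x₀ (by rw [mem_ball]; linarith)
    linarith
  set n : ℝ := (Module.finrank ℝ E : ℝ) with hn
  have hn0 : 0 ≤ n := Nat.cast_nonneg _
  -- the exponent for which the barrier is subharmonic outside the ball of radius `r`
  set α : ℝ := (n + 1) / r ^ 2 with hα
  have hα0 : 0 < α := by positivity
  obtain ⟨Z, K, hβ, hβtr⟩ := hasGradHessOn_exp x₁ α
  set β : E → ℝ := fun x => Real.exp (-α * (‖x - x₁‖ ^ 2 / 2)) with hβdef
  set β₁ : ℝ := Real.exp (-α * ((ρ / 4) ^ 2 / 2)) with hβ₁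
  have hββ₁ : β₁ < β x₀ := by
    refine Real.exp_lt_exp.2 ?_
    rw [← dist_eq_norm]
    have : dist x₀ x₁ ^ 2 < (ρ / 4) ^ 2 := by
      have := dist_nonneg (x := x₀) (y := x₁)
      gcongr
      linarith
    nlinarith
  set ε : ℝ := η * (β x₀ - β₁) / 2 with hε
  have hε0 : 0 < ε := by
    have : 0 < β x₀ - β₁ := by linarith
    positivity
  obtain ⟨δ', hδ', hδ'H⟩ := Metric.eventually_nhds_iff_ball.1
    ((hcont x₀ (mem_ball_self hρ)).eventually (lt_mem_nhds (show 1 - ε < ⟪H x₀ e, e⟫ by linarith)))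
  obtain ⟨δ, hδ0, hδ⟩ := exists_between (lt_min hδ' hr0)
  have hδ1 : δ < δ' := hδ.trans_le (min_le_left _ _)
  have hδ2 : δ < r := hδ.trans_le (min_le_right _ _)
  have hmem : ∀ x ∈ closedBall x₁ (ρ / 4), ∀ τ : ℝ, |τ| ≤ δ → x + τ • e ∈ ball x₀ ρ :=
    fun x hx τ hτ => add_smul_mem_ball (r := 3 * ρ / 8) he (by
      rw [mem_closedBall] at hx; rw [dist_comm] at hx₁
      linarith [dist_triangle x x₁ x₀]) hτ (by linarith)
  have hδabs : |δ| ≤ δ := (abs_of_pos hδ0).le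
  have hδabs' : |-δ| ≤ δ := by rw [abs_neg]; exact hδabs
  have hmem0 : ∀ x ∈ closedBall x₁ (ρ / 4), x ∈ ball x₀ ρ := fun x hx => by
    simpa using hmem x hx 0 (by simpa using hδ0.le)
  have hz := (hv.secondDiff (T := closedBall x₁ (ρ / 4)) (e := e) (δ := δ) hmem0
    (fun x hx => hmem x hx δ hδabs) (fun x hx => hmem x hx (-δ) hδabs')).add
    ((hβ.mono (subset_univ _)).const_mul (η * δ ^ 2))
  set U : Set E := ball x₁ (ρ / 4) \ closedBall x₁ r with hU
  set C : Set E := closedBall x₁ (ρ / 4) \ ball x₁ r with hC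
  have hUsub : U ⊆ closedBall x₁ (ρ / 4) := fun x hx => ball_subset_closedBall hx.1
  obtain ⟨y, ⟨hyK, hyU⟩, hy⟩ := (hz.mono hUsub).exists_le_of_trace_pos
    (isOpen_ball.sdiff isClosed_closedBall) (K := C)
    ((isCompact_closedBall x₁ (ρ / 4)).diff isOpen_ball)
    (fun x hx => ⟨hUsub hx, fun h => hx.2 (ball_subset_closedBall h)⟩)
    (hz.continuousOn.mono sdiff_subset) (fun x hx => by
      have hx' := hUsub hx
      rw [ContinuousLinearMap.toLinearMap_add, map_add, trace_secondDiff,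
        ContinuousLinearMap.toLinearMap_smul, map_smul, hβtr, htr _ (hmem x hx' δ hδabs),
        htr _ (hmem x hx' (-δ) hδabs'),
        htr _ (hmem0 x hx'), smul_eq_mul]
      have hxr : r < ‖x - x₁‖ := by rw [← dist_eq_norm]; exact not_le.1 hx.2
      have h1 : n < α * ‖x - x₁‖ ^ 2 := by
        have : α * r ^ 2 = n + 1 := by rw [hα]; field_simp
        nlinarith [mul_lt_mul_of_pos_left (pow_lt_pow_left₀ hxr hr0.le two_ne_zero) hα0]
      have h2 : 0 < α * ‖x - x₁‖ ^ 2 - n := by linarith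
      have : 0 < η * δ ^ 2 * (Real.exp (-α * (‖x - x₁‖ ^ 2 / 2)) *
        (α * (α * ‖x - x₁‖ ^ 2 - n))) := by positivity
      linarith) (x := x₀) ⟨by rw [mem_closedBall]; linarith, by rw [mem_ball]; linarith⟩
  have h2 := hv.le_secondDiff hδ0.le
    (hmem x₀ (by rw [mem_closedBall]; linarith)) fun τ hτ =>
    (hδ'H (x₀ + τ • e) (add_smul_mem_ball he (dist_self x₀).le hτ (by linarith))).le
  have hkey : v (y + δ • e) + v (y + (-δ) • e) - 2 * v y + η * δ ^ 2 * (β y - β₁) ≤ δ ^ 2 := by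
    have hyK1 : dist y x₁ ≤ ρ / 4 := hyK.1
    have hyK2 : r ≤ dist y x₁ := not_lt.1 hyK.2
    rcases hyK2.lt_or_eq with hlt | heq'
    · -- the outer sphere, where the barrier vanishes
      have h4 : dist y x₁ = ρ / 4 := le_antisymm hyK1 (by
        by_contra! hcon
        exact hyU ⟨hcon, not_le.2 hlt⟩)
      have h5 : β y = β₁ := by rw [hβdef, hβ₁]; simp only; rw [← dist_eq_norm, h4]
      have h1 := hv.secondDiff_le hδ0.le (hmem y hyK.1) fun τ hτ => hle _ (hmem y hyK.1 τ hτ)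
      rw [h5]; linarith
    · -- the inner sphere, where the second derivative is at most `1 - η`
      have h1 := hv.secondDiff_le (c := 1 - η) hδ0.le (hmem y hyK.1) fun τ hτ =>
        (hr'H _ (add_smul_mem_ball he heq'.ge hτ (by linarith))).le
      have h5 : β y - β₁ ≤ 1 := by
        have : β y ≤ 1 := Real.exp_le_one_iff.2 (by
          have : 0 ≤ α * (‖y - x₁‖ ^ 2 / 2) := by positivity
          linarith)
        have : 0 < β₁ := Real.exp_pos _
        linarith
      have : η * δ ^ 2 * (β y - β₁) ≤ η * δ ^ 2 * 1 := by gcongr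
      linarith
  have h3 : 0 < ε * δ ^ 2 := by positivity
  have h4 : η * δ ^ 2 * (β x₀ - β₁) = 2 * (ε * δ ^ 2) := by rw [hε]; ring
  linarith

end HasGradHessOn

end

/-! ### The half square of a shifted distance function -/

section

variable {E : Type*} [NormedAddCommGroup E] [InnerProductSpace ℝ E]

/-- The Hessian `(w + c) A + N ⊗ N` of the function `(w + c) ^ 2 / 2`, where `N` and `A` are the
gradient and the Hessian of `w`. -/
noncomputable def sqHess (w : E → ℝ) (N : E → E) (A : E → E →L[ℝ] E) (c : ℝ) (x : E) : E →L[ℝ] E :=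
  (w x + c) • A x + (innerSL ℝ (N x)).smulRight (N x)

lemma sqHess_apply (w : E → ℝ) (N : E → E) (A : E → E →L[ℝ] E) (c : ℝ) (x a : E) :
    sqHess w N A c x a = (w x + c) • A x a + ⟪N x, a⟫ • N x := by
  simp [sqHess]

lemma inner_sqHess_self (w : E → ℝ) (N : E → E) (A : E → E →L[ℝ] E) (c : ℝ) (x e : E) :
    ⟪sqHess w N A c x e, e⟫ = (w x + c) * ⟪A x e, e⟫ + ⟪N x, e⟫ ^ 2 := by
  rw [sqHess_apply, inner_add_left, real_inner_smul_left, real_inner_smul_left]; ring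

variable [FiniteDimensional ℝ E]

namespace IsoDist

variable {S : Set E} {w : E → ℝ} {N : E → E} {A : E → E →L[ℝ] E} {h : ℝ → ℝ}

lemma hasGradHessOn_sq (H : IsoDist S w N A h) (c : ℝ) :
    HasGradHessOn S (fun x => (w x + c) ^ 2 / 2) (fun x => (w x + c) • N x) (sqHess w N A c) := by
  have := H.toHasGradHessOn.comp_real (φ := fun t => (t + c) ^ 2 / 2) (φ' := fun t => t + c)
    (φ'' := fun _ => 1) (fun x _ => by
      have := ((((hasDerivAt_id (w x)).add_const c).pow 2).div_const 2)
      refine this.congr_deriv ?_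
      simp) (fun x _ => (hasDerivAt_id (w x)).add_const c)
  simp only [one_smul] at this
  exact this

lemma continuousOn_sqHess (H : IsoDist S w N A h) (c : ℝ) : ContinuousOn (sqHess w N A c) S := by
  have h1 := H.toHasGradHessOn.continuousOn
  have h2 := H.continuousOn_grad
  have h3 := H.continuousOn_hess
  have h4 : ContinuousOn (fun x => (innerSL ℝ (N x)).smulRight (N x)) S := by
    have h5 : ContinuousOn (fun x => innerSL ℝ (N x)) S :=
      (innerSL ℝ).continuous.comp_continuousOn h2
    have h6 : Continuous fun p : (E →L[ℝ] ℝ) × E => p.1.smulRight p.2 :=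
      isBoundedBilinearMap_smulRight.continuous
    exact h6.comp_continuousOn (h5.prodMk h2)
  exact ((h1.add continuousOn_const).smul h3).add h4

lemma trace_sqHess (H : IsoDist S w N A h) (c : ℝ) {x : E} (hx : x ∈ S) :
    LinearMap.trace ℝ E (sqHess w N A c x) = (w x + c) * h (w x) + 1 := by
  rw [sqHess, ContinuousLinearMap.toLinearMap_add, map_add, ContinuousLinearMap.toLinearMap_smul,
    map_smul, trace_smulRight, H.trace_hess x hx, real_inner_self_eq_norm_sq, H.norm_grad x hx]
  simp

lemma inner_sqHess_comm (H : IsoDist S w N A h) (c : ℝ) {x : E} (hx : x ∈ S) (a b : E) :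
    ⟪sqHess w N A c x a, b⟫ = ⟪a, sqHess w N A c x b⟫ :=
  (H.hasGradHessOn_sq c).symm H.isOpen hx a b

lemma sqHess_grad (H : IsoDist S w N A h) (c : ℝ) {x : E} (hx : x ∈ S) :
    sqHess w N A c x (N x) = N x := by
  rw [sqHess_apply, H.hess_grad hx, real_inner_self_eq_norm_sq, H.norm_grad x hx]; simp

variable {ι : Type*} [Fintype ι] {b b₀ : OrthonormalBasis ι ℝ E} {l l₀ : ι → ℝ}

/-- An upper bound for the principal curvatures is an upper bound for the second derivatives of the
half square: in the normal direction its second derivative is `1` anyway. -/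
lemma inner_sqHess_self_le (H : IsoDist S w N A h) {c : ℝ} {x : E} (hx : x ∈ S)
    (hb : IsEigenbasis (A x) b l) (hl : ∀ i, (w x + c) * l i ≤ 1) (e : E) :
    ⟪sqHess w N A c x e, e⟫ ≤ ‖e‖ ^ 2 := by
  set a : E := e - ⟪N x, e⟫ • N x with ha
  have hNN : ⟪N x, N x⟫ = 1 := by rw [real_inner_self_eq_norm_sq, H.norm_grad x hx, one_pow]
  have h1 : A x e = A x a := by rw [ha, map_sub, map_smul, H.hess_grad hx]; simp
  have h2 : ⟪A x e, e⟫ = ⟪A x a, a⟫ := by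
    conv_rhs => rw [← h1, ha, inner_sub_right, real_inner_smul_right, H.inner_hess_comm hx e (N x),
      H.hess_grad hx]
    simp
  have h3 : ‖a‖ ^ 2 = ‖e‖ ^ 2 - ⟪N x, e⟫ ^ 2 := by
    rw [ha, norm_sub_sq_real, real_inner_smul_right, norm_smul, H.norm_grad x hx,
      real_inner_comm e, Real.norm_eq_abs, mul_one, sq_abs]
    ring
  have h4 : (w x + c) * ⟪A x a, a⟫ ≤ ‖a‖ ^ 2 := by
    rw [hb.inner_apply_self, Finset.mul_sum, ← b.sum_sq_inner_right]
    refine Finset.sum_le_sum fun i _ => ?_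
    rw [← mul_assoc]
    exact mul_le_of_le_one_left (sq_nonneg _) (hl i)
  rw [inner_sqHess_self, h2]
  linarith

lemma inner_grad_eq_zero (H : IsoDist S w N A h) {x : E} (hx : x ∈ S)
    (hb : IsEigenbasis (A x) b l) {i : ι} (hi : l i ≠ 0) : ⟪N x, b i⟫ = 0 := by
  have h1 := H.inner_hess_comm hx (N x) (b i)
  rw [H.hess_grad hx, hb i, inner_zero_left, real_inner_smul_right] at h1
  exact (mul_eq_zero.1 h1.symm).resolve_left hi

/-! ### At most one nonzero principal curvature -/

/-- If the Hessian of `w` at `x₀` is positive semidefinite with largest eigenvalue `m > 0`, then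
its only eigenvalues are `0` and `m`. Otherwise the second derivative of `(w - w(x₀) + 1/m)² / 2` in
a direction of largest curvature would have a maximum at `x₀` and a positive Laplacian there. -/
lemma eigenvalues_of_nonneg (H : IsoDist S w N A h) {x₀ : E} (hx₀ : x₀ ∈ S)
    (hb₀ : IsEigenbasis (A x₀) b₀ l₀) (hl₀ : ∀ i, 0 ≤ l₀ i) {i₀ : ι} (hm : ∀ i, l₀ i ≤ l₀ i₀)
    (hm0 : 0 < l₀ i₀) (j : ι) : l₀ j = 0 ∨ l₀ j = l₀ i₀ := by
  by_contra! hj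
  obtain ⟨hj0, hjm⟩ := hj
  set m := l₀ i₀ with hmdef
  set c : ℝ := 1 / m - w x₀ with hc
  -- the Laplacian of the half square is a rational function of `w`
  set d : ι → ℝ → ℝ := fun i y => 1 + (y - w x₀) * l₀ i with hd
  set a : ι → ℝ := fun i => 1 - l₀ i / m with ha
  set φ : ℝ → ℝ := fun y => 1 + ∑ i, (1 - a i / d i y) with hφ
  set φ' : ℝ → ℝ := fun y => ∑ i, a i * l₀ i / d i y ^ 2 with hφ'
  set φ'' : ℝ → ℝ := fun y => ∑ i, -2 * a i * l₀ i ^ 2 / d i y ^ 3 with hφ''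
  have hdd : ∀ i y, HasDerivAt (d i) (l₀ i) y := fun i y => by
    have := (((hasDerivAt_id y).sub_const (w x₀)).mul_const (l₀ i)).const_add 1
    exact this.congr_deriv (one_mul _)
  obtain ⟨r, hr0, hr⟩ := Metric.isOpen_iff.1 H.isOpen x₀ hx₀
  obtain ⟨s, hs0, hs⟩ := Metric.eventually_nhds_iff_ball.1
    ((H.eventually_eigenvalues hx₀ hb₀).and ((H.eventually_abs_sub_lt hx₀ hr0).and
      (H.eventually_abs_sub_lt hx₀ (one_div_pos.2 hm0))))
  have hdpos : ∀ x ∈ ball x₀ s, ∀ i, 0 < d i (w x) := fun x hx i => by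
    have h1 := (abs_lt.1 (hs x hx).2.2).1
    have h2 : -(1 / m) * l₀ i ≥ -1 := by
      rw [ge_iff_le, neg_mul, neg_le_neg_iff, one_div_mul_eq_div]
      exact (div_le_one hm0).2 (hm i)
    rcases (hl₀ i).eq_or_lt with h0 | h0
    · simp [hd, ← h0]
    · have := mul_lt_mul_of_pos_right h1 h0
      simp only [hd]; linarith
  have hsS : ball x₀ s ⊆ S := fun x hx => (hs x hx).1.1
  have hle : ∀ x ∈ ball x₀ s, ⟪sqHess w N A c x (b₀ i₀), b₀ i₀⟫ ≤ 1 := fun x hx => by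
    obtain ⟨b, l, hb⟩ := exists_isEigenbasis (H.inner_hess_comm (hsS hx))
    obtain ⟨e⟩ : Nonempty (Fin (Module.finrank ℝ E) ≃ ι) :=
      Fintype.card_eq.1 (by rw [Fintype.card_fin, Module.finrank_eq_card_basis b₀.toBasis])
    have hb' : IsEigenbasis (A x) (b.reindex e) (l ∘ e.symm) := fun i => by
      simpa using hb (e.symm i)
    have hmap := (hs x hx).1.2.2 _ _ hb'
    have := H.inner_sqHess_self_le (c := c) (hsS hx) hb' (fun i => ?_) (b₀ i₀)
    · simpa using this
    have hi : (l ∘ e.symm) i ∈ Finset.univ.val.map (l ∘ e.symm) :=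
      Multiset.mem_map_of_mem _ (Finset.mem_univ i)
    rw [hmap] at hi
    obtain ⟨k, -, hk⟩ := Multiset.mem_map.1 hi
    rw [← hk, ← mul_div_assoc]
    refine (div_le_one (hdpos x hx k)).2 ?_
    have h1 : 1 / m * l₀ k ≤ 1 := by
      rw [one_div_mul_eq_div]; exact (div_le_one hm0).2 (hm k)
    simp only [hc, hd]; linarith
  have htr : ∀ x ∈ ball x₀ s, LinearMap.trace ℝ E (sqHess w N A c x) = φ (w x) := fun x hx => by
    rw [H.trace_sqHess c (hsS hx), show w x = w x₀ + (w x - w x₀) by ring,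
      H.laplacian_line hr (hs x hx).2.1 hb₀, hφ]
    simp only
    rw [add_comm, Finset.mul_sum]
    congr 1
    refine Finset.sum_congr rfl fun i _ => ?_
    have h1 : 1 + (w x - w x₀) * l₀ i ≠ 0 := (hdpos x hx i).ne'
    simp only [hd, ha, hc, add_sub_cancel]
    rw [show w x + (1 / m - w x₀) = (w x - w x₀) + 1 / m by ring]
    generalize w x - w x₀ = t at h1 ⊢
    field_simp
    ring
  have hg := (H.toHasGradHessOn.mono hsS).comp_real (φ := φ) (φ' := φ') (φ'' := φ'')
    (fun x hx => by
      have h1 : HasDerivAt φ (∑ i, -(-(a i * l₀ i) / d i (w x) ^ 2)) (w x) := by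
        refine HasDerivAt.const_add 1 (HasDerivAt.fun_sum fun i _ => ?_)
        refine HasDerivAt.const_sub 1 ?_
        have := (hasDerivAt_const (w x) (a i)).div (hdd i (w x)) (hdpos x hx i).ne'
        exact this.congr_deriv (by simp)
      refine h1.congr_deriv (Finset.sum_congr rfl fun i _ => ?_)
      rw [neg_div, neg_neg])
    (fun x hx => by
      refine HasDerivAt.fun_sum fun i _ => ?_
      have h0 := (hdpos x hx i).ne'
      have := (hasDerivAt_const (w x) (a i * l₀ i)).div ((hdd i (w x)).pow 2) (pow_ne_zero 2 h0)
      refine this.congr_deriv ?_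
      simp only [Pi.pow_apply]
      field_simp
      simp
      ring)
  have hu : ‖b₀ i₀‖ = 1 := b₀.orthonormal.norm_eq_one i₀
  have hN := H.inner_grad_eq_zero hx₀ hb₀ (i := i₀) hm0.ne'
  have hA : ⟪A x₀ (b₀ i₀), b₀ i₀⟫ = m := by
    rw [hb₀ i₀, real_inner_smul_left, real_inner_self_eq_norm_sq, hu]; simp [hmdef]
  have heq : ⟪sqHess w N A c x₀ (b₀ i₀), b₀ i₀⟫ = 1 := by
    rw [inner_sqHess_self, hA, hN, hc]; field_simp; ring
  have hd0 : ∀ i, d i (w x₀) = 1 := fun i => by simp [hd]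
  have hφpos : 0 < φ' (w x₀) := by
    simp only [hφ', hd0, one_pow, div_one]
    have hnn : ∀ i, 0 ≤ a i * l₀ i := fun i =>
      mul_nonneg (sub_nonneg.2 ((div_le_one hm0).2 (hm i))) (hl₀ i)
    refine Finset.sum_pos' (fun i _ => hnn i) ⟨j, Finset.mem_univ j, mul_pos ?_ ?_⟩
    · exact sub_pos.2 ((div_lt_one hm0).2 (lt_of_le_of_ne (hm j) hjm))
    · exact lt_of_le_of_ne (hl₀ j) (Ne.symm hj0)
  -- the Hessian of the Laplacian in the direction of largest curvature is positive near `x₀`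
  have hwc : ContinuousAt w x₀ := (H.grad x₀ hx₀).continuousAt
  have hNc : ContinuousAt N x₀ := (H.hess x₀ hx₀).continuousAt
  have hAc : ContinuousAt A x₀ := H.continuousOn_hess.continuousAt (H.isOpen.mem_nhds hx₀)
  have hdc : ∀ i, ContinuousAt (fun x => d i (w x)) x₀ := fun i => by
    simp only [hd]; fun_prop
  have hφ'c : ContinuousAt (fun x => φ' (w x)) x₀ := by
    refine tendsto_finsetSum _ fun i _ => ?_
    exact continuousAt_const.div ((hdc i).pow 2) (by rw [hd0]; norm_num)
  have hφ''c : ContinuousAt (fun x => φ'' (w x)) x₀ := by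
    refine tendsto_finsetSum _ fun i _ => ?_
    exact continuousAt_const.div ((hdc i).pow 3) (by rw [hd0]; norm_num)
  set q : E → ℝ := fun x => φ' (w x) * ⟪A x (b₀ i₀), b₀ i₀⟫ + φ'' (w x) * ⟪N x, b₀ i₀⟫ ^ 2 with hq
  have hqc : ContinuousAt q x₀ := by
    have h1 : ContinuousAt (fun x => ⟪A x (b₀ i₀), b₀ i₀⟫) x₀ := by fun_prop
    have h2 : ContinuousAt (fun x => ⟪N x, b₀ i₀⟫) x₀ := by fun_prop
    exact (hφ'c.mul h1).add (hφ''c.mul (h2.pow 2))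
  have hq0 : 0 < q x₀ := by
    simp only [hq]; rw [hA, hN]; simpa using mul_pos hφpos hm0
  obtain ⟨ρ, hρ0, hρ⟩ := Metric.eventually_nhds_iff_ball.1
    (hqc.eventually (lt_mem_nhds (half_lt_self hq0)))
  have hsub1 : ball x₀ (2 * (min s ρ / 2)) ⊆ ball x₀ s :=
    ball_subset_ball (by linarith [min_le_left s ρ])
  have hsub2 : ball x₀ (2 * (min s ρ / 2)) ⊆ ball x₀ ρ :=
    ball_subset_ball (by linarith [min_le_right s ρ])
  refine ((H.hasGradHessOn_sq c).mono (hsub1.trans hsS)).not_pos_of_max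
    (by have := lt_min hs0 hρ0; linarith) (hg.mono hsub1) hu
    ((H.continuousOn_sqHess c).mono (hsub1.trans hsS)) (fun x hx => htr x (hsub1 hx))
    (fun x hx => hle x (hsub1 hx)) heq (half_pos hq0) fun x hx => ?_
  refine (hρ x (hsub2 hx)).le.trans_eq ?_
  simp only [hq, _root_.add_apply, _root_.smul_apply, ContinuousLinearMap.smulRight_apply,
    innerSL_apply_apply, inner_add_left, real_inner_smul_left, smul_eq_mul]
  ring

end IsoDist

end

/-! ### Passing to parallel hypersurfaces -/

section

variable {E : Type*} [NormedAddCommGroup E] [InnerProductSpace ℝ E]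

lemma IsEigenbasis.comp_symm {ι : Type*} [Fintype ι] {T : E →L[ℝ] E} {b : OrthonormalBasis ι ℝ E}
    {l : ι → ℝ} (hb : IsEigenbasis T b l) {r : ℝ} {e : E ≃L[ℝ] E}
    (he : (e : E →L[ℝ] E) = ContinuousLinearMap.id ℝ E + r • T) :
    IsEigenbasis (T.comp (e.symm : E →L[ℝ] E)) b fun i => l i / (1 + r * l i) := fun i => by
  have h1 : e (b i) = (1 + r * l i) • b i := by
    have := DFunLike.congr_fun he (b i)
    simp only [ContinuousLinearEquiv.coe_coe] at this
    rw [this, add_smul, one_smul, mul_smul, ← hb i]; simp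
  have h0 : 1 + r * l i ≠ 0 := fun h0 => by
    rw [h0, zero_smul] at h1
    exact b.orthonormal.ne_zero i ((map_eq_zero_iff e e.injective).1 h1)
  have h2 : e.symm (b i) = (1 + r * l i)⁻¹ • b i := by
    rw [e.symm_apply_eq, map_smul, h1, smul_smul, inv_mul_cancel₀ h0, one_smul]
  simp only [ContinuousLinearMap.comp_apply, ContinuousLinearEquiv.coe_coe]
  rw [h2, map_smul, hb i, smul_smul, div_eq_inv_mul]

variable [FiniteDimensional ℝ E]

lemma IsEigenbasis.exists_equiv {ι : Type*} [Fintype ι] {T : E →L[ℝ] E}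
    {b : OrthonormalBasis ι ℝ E} {l : ι → ℝ} (hb : IsEigenbasis T b l) {r : ℝ}
    (hr : ∀ i, 1 + r * l i ≠ 0) :
    ∃ e : E ≃L[ℝ] E, (e : E →L[ℝ] E) = ContinuousLinearMap.id ℝ E + r • T := by
  set D : E →L[ℝ] E := ContinuousLinearMap.id ℝ E + r • T with hD
  have hinj : Function.Injective (D : E →ₗ[ℝ] E) := by
    rw [← LinearMap.ker_eq_bot, LinearMap.ker_eq_bot']
    intro a ha
    refine InnerProductSpace.ext_inner_left_basis b.toBasis fun i => ?_
    have h1 : ⟪b i, D a⟫ = 0 := by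
      rw [show D a = 0 from ha, inner_zero_right]
    rw [hD] at h1
    simp only [_root_.add_apply, _root_.smul_apply, ContinuousLinearMap.id_apply, inner_add_right,
      real_inner_smul_right, hb.inner_apply] at h1
    have h2 : (1 + r * l i) * ⟪b i, a⟫ = 0 := by linarith
    simpa using (mul_eq_zero.1 h2).resolve_left (hr i)
  exact ⟨(LinearEquiv.ofInjectiveEndo (D : E →ₗ[ℝ] E) hinj).toContinuousLinearEquiv, by ext; rfl⟩

namespace IsoDist

variable {S : Set E} {w : E → ℝ} {N : E → E} {A : E → E →L[ℝ] E} {h : ℝ → ℝ}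
variable {ι : Type*} [Fintype ι] {b₀ : OrthonormalBasis ι ℝ E} {l₀ : ι → ℝ}

/-- The parallel hypersurfaces of the level sets of `w` at an arbitrary distance `r`, possibly
beyond focal points, are locally the level sets of another isoparametric distance function. Its
Laplacian is again a function of its value because `w` determines the eigenvalues of the Hessian
with their multiplicities. -/
lemma exists_parallel (H : IsoDist S w N A h) {x₀ : E} (hx₀ : x₀ ∈ S)
    (hb₀ : IsEigenbasis (A x₀) b₀ l₀) {r : ℝ} (hr : ∀ i, 1 + r * l₀ i ≠ 0) :
    ∃ (S' : Set E) (w' : E → ℝ) (N' : E → E) (A' : E → E →L[ℝ] E) (h' : ℝ → ℝ) (y₀ : E),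
      IsoDist S' w' N' A' h' ∧ y₀ ∈ S' ∧
        IsEigenbasis (A' y₀) b₀ fun i => l₀ i / (1 + r * l₀ i) := by
  set Φ : E → E := fun x => x + r • N x with hΦ
  set D : E → E →L[ℝ] E := fun x => ContinuousLinearMap.id ℝ E + r • A x with hD
  have hDΦ : ∀ x ∈ S, HasFDerivAt Φ (D x) x := fun x hx =>
    (hasFDerivAt_id x).add ((H.hess x hx).const_smul r)
  have hDc : ContinuousOn D S := continuousOn_const.add (H.continuousOn_hess.const_smul r)
  obtain ⟨e₀, he₀⟩ := hb₀.exists_equiv hr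
  have hΦc : ContDiffAt ℝ 1 Φ x₀ :=
    contDiffAt_one_iff.2 ⟨D, S, H.isOpen.mem_nhds hx₀, hDc, hDΦ⟩
  have hΦ' : HasFDerivAt Φ (e₀ : E →L[ℝ] E) x₀ := by rw [he₀]; exact hDΦ x₀ hx₀
  set P := hΦc.toOpenPartialHomeomorph Φ hΦ' one_ne_zero with hP
  have hPc : (P : E → E) = Φ := hΦc.toOpenPartialHomeomorph_coe hΦ' one_ne_zero
  have hx₀P : x₀ ∈ P.source := hΦc.mem_toOpenPartialHomeomorph_source hΦ' one_ne_zero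
  have hev : ∀ᶠ x in 𝓝 x₀, ∃ e : E ≃L[ℝ] E, (e : E →L[ℝ] E) = D x := by
    have h1 : range ((↑) : (E ≃L[ℝ] E) → E →L[ℝ] E) ∈ 𝓝 (D x₀) :=
      ContinuousLinearEquiv.isOpen.mem_nhds ⟨e₀, he₀⟩
    filter_upwards [(hDc.continuousAt (H.isOpen.mem_nhds hx₀)).preimage_mem_nhds h1] with x hx
      using hx
  obtain ⟨s, hs0, hs⟩ := Metric.eventually_nhds_iff_ball.1
    ((H.eventually_eigenvalues hx₀ hb₀).and hev)
  set X : E → E := (P.symm : E → E) with hX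
  set S' : Set E := P.target ∩ X ⁻¹' ball x₀ s with hS'
  have hXS : ∀ y ∈ S', X y ∈ S := fun y hy => (hs _ hy.2).1.1
  have hXder : ∀ y ∈ S', ∀ e : E ≃L[ℝ] E, (e : E →L[ℝ] E) = D (X y) →
      HasFDerivAt X (e.symm : E →L[ℝ] E) y := fun y hy e he => by
    refine P.hasFDerivAt_symm hy.1 ?_
    rw [he, hPc]; exact hDΦ _ (hXS y hy)
  have hXc : ContinuousOn X S' := P.continuousOn_symm.mono inter_subset_left
  have hinv : ∀ (y : E) (e : E ≃L[ℝ] E), (e : E →L[ℝ] E) = D (X y) →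
      ContinuousLinearMap.inverse (D (X y)) = (e.symm : E →L[ℝ] E) := fun y e he => by
    rw [← he, ContinuousLinearMap.inverse_equiv]
  refine ⟨S', fun y => w (X y) + r, fun y => N (X y),
    fun y => (A (X y)).comp (ContinuousLinearMap.inverse (D (X y))),
    fun t => ∑ i, (l₀ i / (1 + (t - r - w x₀) * l₀ i)) /
      (1 + r * (l₀ i / (1 + (t - r - w x₀) * l₀ i))), Φ x₀, ⟨⟨?_, ?_⟩, ?_, ?_, ?_, ?_⟩, ?_, ?_⟩
  · intro y hy
    obtain ⟨e, he⟩ := (hs _ hy.2).2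
    have h1 := ((H.grad _ (hXS y hy)).hasFDerivAt.comp y (hXder y hy e he)).add_const r
    rw [hasGradientAt_iff_hasFDerivAt]
    refine h1.congr_fderiv ?_
    ext a
    obtain ⟨a, rfl⟩ := e.surjective a
    have h2 : e a = a + r • A (X y) a := by
      have := DFunLike.congr_fun he a
      simpa [hD] using this
    simp only [ContinuousLinearMap.comp_apply, ContinuousLinearEquiv.coe_coe,
      ContinuousLinearEquiv.symm_apply_apply, InnerProductSpace.toDual_apply_apply]
    rw [h2, inner_add_right, real_inner_smul_right, ← H.inner_hess_comm (hXS y hy),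
      H.hess_grad (hXS y hy)]
    simp
  · intro y hy
    obtain ⟨e, he⟩ := (hs _ hy.2).2
    rw [hinv y e he]
    exact (H.hess _ (hXS y hy)).comp y (hXder y hy e he)
  · exact P.symm.isOpen_inter_preimage isOpen_ball
  · exact fun y hy => H.norm_grad _ (hXS y hy)
  · intro y hy
    obtain ⟨e, he⟩ := (hs _ hy.2).2
    have h1 : ContinuousWithinAt (fun y => A (X y)) S' y := (H.continuousOn_hess.comp hXc hXS) y hy
    have h2 : ContinuousWithinAt (fun y => D (X y)) S' y := (hDc.comp hXc hXS) y hy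
    have h3 : ContinuousAt (ContinuousLinearMap.inverse : (E →L[ℝ] E) → E →L[ℝ] E) (D (X y)) := by
      rw [← he]; exact (contDiffAt_map_inverse (n := 0) e).continuousAt
    exact h1.clm_comp (ContinuousAt.comp_continuousWithinAt (f := fun y => D (X y)) h3 h2)
  · intro y hy
    obtain ⟨e, he⟩ := (hs _ hy.2).2
    obtain ⟨b, l, hb⟩ := exists_isEigenbasis (H.inner_hess_comm (hXS y hy))
    obtain ⟨σ⟩ : Nonempty (Fin (Module.finrank ℝ E) ≃ ι) :=
      Fintype.card_eq.1 (by rw [Fintype.card_fin, Module.finrank_eq_card_basis b₀.toBasis])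
    have hb' : IsEigenbasis (A (X y)) (b.reindex σ) (l ∘ σ.symm) := fun i => by
      simpa using hb (σ.symm i)
    have hmap := (hs _ hy.2).1.2.2 _ _ hb'
    rw [hinv y e he, (hb'.comp_symm he).trace_eq]
    have := congrArg (fun m => (Multiset.map (fun a : ℝ => a / (1 + r * a)) m).sum) hmap
    simp only [Multiset.map_map, Function.comp_def] at this
    simp only [add_sub_cancel_right]
    exact this
  · have h1 : Φ x₀ ∈ P.target := by rw [← hPc]; exact P.map_source hx₀P
    have h2 : X (Φ x₀) = x₀ := by rw [hX, ← hPc]; exact P.left_inv hx₀P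
    exact ⟨h1, by rw [mem_preimage, h2]; exact mem_ball_self hs0⟩
  · have h2 : X (Φ x₀) = x₀ := by rw [hX, ← hPc]; exact P.left_inv hx₀P
    simp only [h2]
    rw [show D x₀ = (e₀ : E →L[ℝ] E) from he₀.symm, ContinuousLinearMap.inverse_equiv]
    exact hb₀.comp_symm he₀

/-- At each point the Hessian of `w` has at most one nonzero eigenvalue. At a sufficiently distant
parallel hypersurface all nonzero eigenvalues are positive, and the maximum principle applies. -/
theorem eigenvalues_eq (H : IsoDist S w N A h) {x₀ : E} (hx₀ : x₀ ∈ S)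
    (hb₀ : IsEigenbasis (A x₀) b₀ l₀) (i j : ι) (hi : l₀ i ≠ 0) (hj : l₀ j ≠ 0) :
    l₀ i = l₀ j := by
  set r : ℝ := 1 + ∑ i, |l₀ i|⁻¹ with hr
  have hr1 : ∀ i, l₀ i ≠ 0 → 1 < r * |l₀ i| := fun i hi => by
    have h1 : |l₀ i|⁻¹ ≤ ∑ i, |l₀ i|⁻¹ :=
      Finset.single_le_sum (f := fun i => |l₀ i|⁻¹) (fun i _ => by positivity) (Finset.mem_univ i)
    have h2 : 0 < |l₀ i| := abs_pos.2 hi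
    calc (1 : ℝ) = |l₀ i|⁻¹ * |l₀ i| := (inv_mul_cancel₀ h2.ne').symm
      _ < r * |l₀ i| := by gcongr; linarith
  have hr0 : 0 < r := by
    have : 0 ≤ ∑ i, |l₀ i|⁻¹ := Finset.sum_nonneg fun i _ => by positivity
    linarith
  have hpos : ∀ i, l₀ i ≠ 0 → 1 + r * l₀ i ≠ 0 ∧ 0 < l₀ i / (1 + r * l₀ i) := fun i hi => by
    have h1 := hr1 i hi
    rcases hi.lt_or_gt with h0 | h0
    · rw [abs_of_neg h0] at h1
      have h2 : 1 + r * l₀ i < 0 := by linarith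
      exact ⟨h2.ne, div_pos_of_neg_of_neg h0 h2⟩
    · have h2 : 0 < 1 + r * l₀ i := by positivity
      exact ⟨h2.ne', div_pos h0 h2⟩
  have hne : ∀ i, 1 + r * l₀ i ≠ 0 := fun i => by
    by_cases h0 : l₀ i = 0
    · rw [h0]; simp
    · exact (hpos i h0).1
  obtain ⟨S', w', N', A', h', y₀, H', hy₀, hb'⟩ := H.exists_parallel hx₀ hb₀ hne
  obtain ⟨i₀, -, hi₀⟩ := Finset.exists_max_image Finset.univ
    (fun i => l₀ i / (1 + r * l₀ i)) ⟨i, Finset.mem_univ i⟩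
  have hnn : ∀ i, 0 ≤ l₀ i / (1 + r * l₀ i) := fun i => by
    by_cases h0 : l₀ i = 0
    · rw [h0]; simp
    · exact (hpos i h0).2.le
  have key := H'.eigenvalues_of_nonneg hy₀ hb' hnn (fun k => hi₀ k (Finset.mem_univ k))
    ((hpos i hi).2.trans_le (hi₀ i (Finset.mem_univ i)))
  have h1 := ((key i).resolve_left (hpos i hi).2.ne').trans
    ((key j).resolve_left (hpos j hj).2.ne').symm
  rw [div_eq_div_iff (hne i) (hne j)] at h1
  linarith

end IsoDist

end

/-! ### Local constancy of the Hessian of the half square -/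

section

variable {E : Type*} [NormedAddCommGroup E] [InnerProductSpace ℝ E]

lemma norm_sub_sq_of_idempotent {R : E →L[ℝ] E} (hs : ∀ a b, ⟪R a, b⟫ = ⟪a, R b⟫)
    (hR : ∀ a, R (R a) = R a) (e : E) : ‖e - R e‖ ^ 2 = ‖e‖ ^ 2 - ⟪R e, e⟫ := by
  have h1 : ‖R e‖ ^ 2 = ⟪R e, e⟫ := by
    rw [← real_inner_self_eq_norm_sq, ← hs, hR]
  rw [norm_sub_sq_real, h1, real_inner_comm]; ring

lemma eq_zero_of_idempotent_of_trace [FiniteDimensional ℝ E] {R : E →L[ℝ] E}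
    (hs : ∀ a b, ⟪R a, b⟫ = ⟪a, R b⟫) (hR : ∀ a, R (R a) = R a)
    (ht : LinearMap.trace ℝ E R = 0) : R = 0 := by
  rw [LinearMap.trace_eq_sum_inner _ (stdOrthonormalBasis ℝ E)] at ht
  have h1 : ∀ a, ⟪a, R a⟫ = ‖R a‖ ^ 2 := fun a => by
    rw [← real_inner_self_eq_norm_sq, hs, hR]
  simp only [ContinuousLinearMap.coe_coe, h1] at ht
  have h2 := (Finset.sum_eq_zero_iff_of_nonneg fun i _ => sq_nonneg _).1 ht
  refine ContinuousLinearMap.coe_injective ((stdOrthonormalBasis ℝ E).toBasis.ext fun i => ?_)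
  have := h2 i (Finset.mem_univ i)
  simpa using this

variable [FiniteDimensional ℝ E]

lemma trace_le_finrank_of_idempotent {R : E →L[ℝ] E} (hs : ∀ a b, ⟪R a, b⟫ = ⟪a, R b⟫)
    (hR : ∀ a, R (R a) = R a) : LinearMap.trace ℝ E R ≤ Module.finrank ℝ E := by
  rw [LinearMap.trace_eq_sum_inner _ (stdOrthonormalBasis ℝ E)]
  calc ∑ i, ⟪stdOrthonormalBasis ℝ E i, R (stdOrthonormalBasis ℝ E i)⟫
      ≤ ∑ _i : Fin (Module.finrank ℝ E), (1 : ℝ) := by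
        refine Finset.sum_le_sum fun i _ => ?_
        have h1 := norm_sub_sq_of_idempotent hs hR (stdOrthonormalBasis ℝ E i)
        have h2 := sq_nonneg ‖stdOrthonormalBasis ℝ E i - R (stdOrthonormalBasis ℝ E i)‖
        rw [(stdOrthonormalBasis ℝ E).orthonormal.norm_eq_one i] at h1
        rw [real_inner_comm]
        linarith
    _ = Module.finrank ℝ E := by simp

namespace IsoDist

variable {S : Set E} {w : E → ℝ} {N : E → E} {A : E → E →L[ℝ] E} {h : ℝ → ℝ}
variable {ι : Type*} [Fintype ι] {b₀ : OrthonormalBasis ι ℝ E} {l₀ : ι → ℝ}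

/-- If the eigenvalues of the Hessian of `w` at `x₀` are `0` and `m`, then near `x₀` the Hessian of
the half square of `w - w(x₀) + 1/m` is a projection of fixed rank. -/
lemma eventually_sqHess_idempotent (H : IsoDist S w N A h) {x₀ : E} (hx₀ : x₀ ∈ S)
    (hb₀ : IsEigenbasis (A x₀) b₀ l₀) {m : ℝ} (hm0 : m ≠ 0) (hm : ∀ i, l₀ i = 0 ∨ l₀ i = m) :
    ∀ᶠ x in 𝓝 x₀, x ∈ S ∧
      (∀ a, sqHess w N A (1 / m - w x₀) x (sqHess w N A (1 / m - w x₀) x a) =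
        sqHess w N A (1 / m - w x₀) x a) ∧
      LinearMap.trace ℝ E (sqHess w N A (1 / m - w x₀) x) = 1 + ∑ i, l₀ i / m := by
  classical
  obtain ⟨r, hr0, hr⟩ := Metric.isOpen_iff.1 H.isOpen x₀ hx₀
  have hm' : 0 < |1 / m| := abs_pos.2 (one_div_ne_zero hm0)
  filter_upwards [H.eventually_eigenvalues hx₀ hb₀, H.eventually_abs_sub_lt hx₀ hr0,
    H.eventually_abs_sub_lt hx₀ hm'] with x hx hxr hxm
  obtain ⟨hxS, hne, hx⟩ := hx
  set t := w x - w x₀ with ht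
  have hs : w x + (1 / m - w x₀) = t + 1 / m := by rw [ht]; ring
  have hs0 : t + 1 / m ≠ 0 := fun h0 => by
    rw [eq_neg_of_add_eq_zero_left h0, abs_neg] at hxm
    exact lt_irrefl _ hxm
  have htm : (t + 1 / m) * m = 1 + t * m := by field_simp; ring
  have htm0 : 1 + t * m ≠ 0 := by rw [← htm]; exact mul_ne_zero hs0 hm0
  have hlin : ∀ i, (t + 1 / m) * (l₀ i / (1 + t * l₀ i)) = l₀ i / m := fun i => by
    rcases hm i with h0 | h0
    · simp [h0]
    · rw [h0, ← mul_div_assoc, htm, div_self htm0, div_self hm0]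
  refine ⟨hxS, fun a => ?_, ?_⟩
  · obtain ⟨b, l, hb⟩ := exists_isEigenbasis (H.inner_hess_comm hxS)
    obtain ⟨σ⟩ : Nonempty (Fin (Module.finrank ℝ E) ≃ ι) :=
      Fintype.card_eq.1 (by rw [Fintype.card_fin, Module.finrank_eq_card_basis b₀.toBasis])
    have hb' : IsEigenbasis (A x) (b.reindex σ) (l ∘ σ.symm) := fun i => by
      simpa using hb (σ.symm i)
    have hmap := hx _ _ hb'
    have hsq : ∀ i, (l ∘ σ.symm) i * (l ∘ σ.symm) i = (t + 1 / m)⁻¹ * (l ∘ σ.symm) i :=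
        fun i => by
      have hi : (l ∘ σ.symm) i ∈ Finset.univ.val.map (l ∘ σ.symm) :=
        Multiset.mem_map_of_mem _ (Finset.mem_univ i)
      rw [hmap] at hi
      obtain ⟨k, -, hk⟩ := Multiset.mem_map.1 hi
      rw [← hk, eq_inv_mul_iff_mul_eq₀ hs0, ← mul_assoc, hlin]
      rcases hm k with h0 | h0
      · simp [h0]
      · rw [h0, div_self hm0, one_mul]
    have hAA := hb'.apply_apply_of_sq_eq hsq a
    have hNA : ⟪N x, A x a⟫ = 0 := by
      rw [← H.inner_hess_comm hxS, H.hess_grad hxS, inner_zero_left]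
    have hNN : ⟪N x, N x⟫ = 1 := by rw [real_inner_self_eq_norm_sq, H.norm_grad x hxS, one_pow]
    simp only [sqHess_apply, hs, map_add, map_smul, hAA, H.hess_grad hxS, hNA, hNN, smul_zero,
      zero_add, zero_smul, one_smul, add_zero]
    rw [smul_smul (t + 1 / m) (t + 1 / m)⁻¹, mul_inv_cancel₀ hs0, one_smul]
  · rw [H.trace_sqHess _ hxS, hs, show w x = w x₀ + t by rw [ht]; ring,
      H.laplacian_line hr hxr hb₀, Finset.mul_sum, add_comm]
    congr 1
    exact Finset.sum_congr rfl fun i _ => hlin i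

/-- In the situation of `eventually_sqHess_idempotent` the Hessian of the half square is constant
near `x₀`: by the strong maximum principle its range cannot move. -/
lemma eventually_sqHess_eq (H : IsoDist S w N A h) {x₀ : E} (hx₀ : x₀ ∈ S)
    (hb₀ : IsEigenbasis (A x₀) b₀ l₀) {m : ℝ} (hm0 : m ≠ 0) (hm : ∀ i, l₀ i = 0 ∨ l₀ i = m) :
    ∀ᶠ x in 𝓝 x₀, sqHess w N A (1 / m - w x₀) x = sqHess w N A (1 / m - w x₀) x₀ := by
  obtain ⟨ρ, hρ0, hρ⟩ := Metric.eventually_nhds_iff_ball.1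
    (H.eventually_sqHess_idempotent hx₀ hb₀ hm0 hm)
  set c := 1 / m - w x₀
  set R := sqHess w N A c with hRdef
  have hsub : ball x₀ ρ ⊆ S := fun x hx => (hρ x hx).1
  have hsymm : ∀ x ∈ ball x₀ ρ, ∀ a b, ⟪R x a, b⟫ = ⟪a, R x b⟫ := fun x hx =>
    H.inner_sqHess_comm c (hsub hx)
  have hidem : ∀ x ∈ ball x₀ ρ, ∀ a, R x (R x a) = R x a := fun x hx => (hρ x hx).2.1
  have h₀ : x₀ ∈ ball x₀ ρ := mem_ball_self hρ0
  filter_upwards [ball_mem_nhds x₀ (show 0 < ρ / 8 by linarith)] with x hx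
  have hx' : x ∈ ball x₀ ρ := ball_subset_ball (by linarith) hx
  have hunit : ∀ e : E, ‖e‖ = 1 → R x₀ e = e → R x e = e := fun e he hRe => by
    have h1 := ((H.hasGradHessOn_sq c).mono hsub).eq_one_of_max hρ0 he
      ((H.continuousOn_sqHess c).mono hsub) (fun y hy => (hρ y hy).2.2)
      (fun y hy => by
        have h1 := norm_sub_sq_of_idempotent (hsymm y hy) (hidem y hy) e
        have h2 := sq_nonneg ‖e - R y e‖
        rw [he] at h1
        linarith)
      (by rw [← hRdef, hRe, real_inner_self_eq_norm_sq, he, one_pow]) hx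
    have h2 := norm_sub_sq_of_idempotent (hsymm x hx') (hidem x hx') e
    rw [he, h1] at h2
    have h3 : ‖e - R x e‖ = 0 := by
      have : ‖e - R x e‖ ^ 2 = 0 := by rw [h2]; norm_num
      exact pow_eq_zero_iff two_ne_zero |>.1 this
    exact (sub_eq_zero.1 (norm_eq_zero.1 h3)).symm
  have hRR : ∀ a, R x (R x₀ a) = R x₀ a := fun a => by
    by_cases h0 : R x₀ a = 0
    · rw [h0, map_zero]
    · have h1 := hunit (‖R x₀ a‖⁻¹ • R x₀ a) (by
        rw [norm_smul, norm_inv, norm_norm, inv_mul_cancel₀ (norm_ne_zero_iff.2 h0)])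
        (by rw [map_smul, hidem x₀ h₀])
      rw [map_smul] at h1
      exact smul_right_injective E (inv_ne_zero (norm_ne_zero_iff.2 h0)) h1
  have hRR' : ∀ a, R x₀ (R x a) = R x₀ a := fun a => by
    refine ext_inner_right ℝ fun b => ?_
    rw [hsymm x₀ h₀, hsymm x hx', hRR, hsymm x₀ h₀]
  refine sub_eq_zero.1 (eq_zero_of_idempotent_of_trace (R := R x - R x₀) (fun a b => ?_)
    (fun a => ?_) ?_)
  · simp only [_root_.sub_apply, inner_sub_left, inner_sub_right, hsymm x hx', hsymm x₀ h₀]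
  · simp only [_root_.sub_apply, map_sub, hidem x hx', hidem x₀ h₀, hRR, hRR']
    abel
  · rw [ContinuousLinearMap.toLinearMap_sub, map_sub, (hρ x hx').2.2, (hρ x₀ h₀).2.2, sub_self]

/-! ### Global structure of isoparametric distance functions -/

lemma _root_.IsPreconnected.eq_of_eventually_eq {X Y : Type*} [TopologicalSpace X]
    [TopologicalSpace Y] [T1Space Y] {S : Set X} (hS : IsPreconnected S) (hSo : IsOpen S)
    {f : X → Y} (hf : ContinuousOn f S) {x₀ : X} (hx₀ : x₀ ∈ S)
    (hev : ∀ x ∈ S, f x = f x₀ → ∀ᶠ y in 𝓝 x, f y = f x₀) : ∀ x ∈ S, f x = f x₀ := by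
  have hopen : IsOpen {x ∈ S | f x = f x₀} := isOpen_iff_mem_nhds.2 fun x hx => by
    filter_upwards [hSo.mem_nhds hx.1, hev x hx.1 hx.2] with y h1 h2 using ⟨h1, h2⟩
  have hsub := hS.subset_of_closure_inter_subset hopen ⟨x₀, hx₀, hx₀, rfl⟩ (by
    rintro x ⟨hxc, hxS⟩
    refine ⟨hxS, ?_⟩
    have h1 : f x ∈ closure {f x₀} := by
      refine closure_mono ?_ (mem_closure_image (s := {x ∈ S | f x = f x₀}) (f := f) ?_ hxc)
      · rintro _ ⟨y, hy, rfl⟩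
        exact hy.2
      · exact hf.continuousAt (hSo.mem_nhds hxS)
    rwa [closure_singleton] at h1)
  exact fun x hx => (hsub hx).2

/-- If the Laplacian of `w` vanishes at one point, then `w` is affine. -/
theorem eq_inner_of_trace_eq_zero (H : IsoDist S w N A h) (hS : IsPreconnected S) {x₀ : E}
    (hx₀ : x₀ ∈ S) (h0 : h (w x₀) = 0) :
    (∀ x ∈ S, h (w x) = 0) ∧ ∀ x ∈ S, w x - w x₀ = ⟪N x₀, x - x₀⟫ := by
  have hA₀ : A x₀ = 0 := by
    obtain ⟨b, l, hb⟩ := exists_isEigenbasis (H.inner_hess_comm hx₀)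
    exact hb.eq_zero_of_trace (H.eigenvalues_eq hx₀ hb) (by rw [H.trace_hess x₀ hx₀, h0])
  have hA : ∀ x ∈ S, A x = 0 := fun x hx => by
    rw [← hA₀]
    refine hS.eq_of_eventually_eq H.isOpen H.continuousOn_hess hx₀ (fun x hx hAx => ?_) x hx
    rw [hA₀] at hAx ⊢
    have hb : IsEigenbasis (A x) (stdOrthonormalBasis ℝ E) 0 := fun i => by simp [hAx]
    filter_upwards [H.eventually_eigenvalues hx hb] with y hy
    obtain ⟨b, l, hb'⟩ := exists_isEigenbasis (H.inner_hess_comm hy.1)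
    refine hb'.eq_zero fun i => ?_
    have hi : l i ∈ Finset.univ.val.map l := Multiset.mem_map_of_mem _ (Finset.mem_univ i)
    rw [hy.2.2 b l hb'] at hi
    obtain ⟨k, -, hk⟩ := Multiset.mem_map.1 hi
    simpa using hk.symm
  have hN : ∀ x ∈ S, N x = N x₀ := fun x hx =>
    H.isOpen.is_const_of_fderiv_eq_zero (𝕜 := ℝ) hS
      (fun y hy => (H.hess y hy).differentiableAt.differentiableWithinAt)
      (fun y hy => by rw [(H.hess y hy).fderiv, hA y hy]; rfl) hx hx₀
  refine ⟨fun x hx => by rw [← H.trace_hess x hx, hA x hx]; simp, fun x hx => ?_⟩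
  have hd : ∀ y ∈ S, HasFDerivAt (fun y => w y - innerSL ℝ (N x₀) y) (0 : E →L[ℝ] ℝ) y :=
    fun y hy => by
      refine ((H.grad y hy).hasFDerivAt.sub (innerSL ℝ (N x₀)).hasFDerivAt).congr_fderiv ?_
      rw [hN y hy]; ext a; simp
  have := H.isOpen.is_const_of_fderiv_eq_zero (𝕜 := ℝ) hS
    (fun y hy => (hd y hy).differentiableAt.differentiableWithinAt)
    (fun y hy => (hd y hy).fderiv) hx hx₀
  simp only [innerSL_apply_apply] at this
  rw [inner_sub_right]; linarith

/-- If the Laplacian `C` of `w` is positive at one point, then `w` is up to a constant the distance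
from an affine subspace of codimension `k ≥ 2`. -/
theorem eq_norm_of_trace_pos (H : IsoDist S w N A h) (hS : IsPreconnected S) {x₀ : E}
    (hx₀ : x₀ ∈ S) (hC : 0 < h (w x₀)) :
    ∃ k : ℕ, 2 ≤ k ∧ k ≤ Module.finrank ℝ E ∧ ∃ (R : E →L[ℝ] E) (z : E),
      (∀ a b, ⟪R a, b⟫ = ⟪a, R b⟫) ∧ (∀ a, R (R a) = R a) ∧ LinearMap.trace ℝ E R = k ∧
      ∀ x ∈ S, 0 < ((k : ℝ) - 1) / h (w x₀) + (w x - w x₀) ∧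
        h (w x) = ((k : ℝ) - 1) / (((k : ℝ) - 1) / h (w x₀) + (w x - w x₀)) ∧
        ‖R (x - z)‖ = ((k : ℝ) - 1) / h (w x₀) + (w x - w x₀) := by
  classical
  obtain ⟨b₀, l₀, hb₀⟩ := exists_isEigenbasis (H.inner_hess_comm hx₀)
  have htr₀ : ∑ i, l₀ i = h (w x₀) := by rw [← hb₀.trace_eq, H.trace_hess x₀ hx₀]
  obtain ⟨i₀, -, hi₀⟩ : ∃ i ∈ Finset.univ, l₀ i ≠ 0 :=
    Finset.exists_ne_zero_of_sum_ne_zero (by rw [htr₀]; exact hC.ne')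
  set m := l₀ i₀ with hm
  have hm' : ∀ i, l₀ i = 0 ∨ l₀ i = m := fun i => by
    by_cases h0 : l₀ i = 0
    · exact Or.inl h0
    · exact Or.inr (H.eigenvalues_eq hx₀ hb₀ i i₀ h0 hi₀)
  set p : ℕ := (Finset.univ.filter fun i => l₀ i ≠ 0).card with hp
  have hp1 : 1 ≤ p := Finset.card_pos.2 ⟨i₀, by simp [← hm, hi₀]⟩
  have hpsum : ∑ i, l₀ i / m = p := by
    rw [hp, Finset.card_filter, Nat.cast_sum]
    refine Finset.sum_congr rfl fun i _ => ?_
    rcases hm' i with h0 | h0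
    · simp [h0]
    · rw [h0, div_self hi₀]; simp [hi₀]
  have hCm : h (w x₀) = p * m := by
    rw [← htr₀, ← hpsum, Finset.sum_mul]
    exact Finset.sum_congr rfl fun i _ => (div_mul_cancel₀ _ hi₀).symm
  have hp0 : (0 : ℝ) < p := by exact_mod_cast hp1
  have hm_pos : 0 < m := by
    rw [hCm] at hC
    exact (pos_iff_pos_of_mul_pos hC).1 hp0
  have hk : (((1 + p : ℕ) : ℝ) - 1) / h (w x₀) = 1 / m := by
    rw [hCm]; push_cast; field_simp; ring
  set c : ℝ := 1 / m - w x₀ with hc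
  set R := sqHess w N A c x₀ with hR
  obtain ⟨-, hidem, htr⟩ := (H.eventually_sqHess_idempotent hx₀ hb₀ hi₀ hm').self_of_nhds
  rw [hpsum] at htr
  have hsymm := H.inner_sqHess_comm c hx₀
  -- where the Hessian of the half square is `R`, the shifted distance does not vanish, since
  -- otherwise that Hessian would have rank one
  have hs_ne : ∀ x ∈ S, sqHess w N A c x = R → w x + c ≠ 0 := fun x hx hxR h0 => by
    have h1 := H.trace_sqHess c hx
    rw [hxR, htr, h0] at h1
    linarith
  have hconst : ∀ x ∈ S, sqHess w N A c x = R := by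
    refine hS.eq_of_eventually_eq H.isOpen (H.continuousOn_sqHess c) hx₀ fun x hx hxR => ?_
    have hs := hs_ne x hx hxR
    obtain ⟨b, l, hb⟩ := exists_isEigenbasis (H.inner_hess_comm hx)
    have hl : ∀ i, l i = 0 ∨ l i = (w x + c)⁻¹ := fun i => by
      by_cases h0 : l i = 0
      · exact Or.inl h0
      right
      have h1 : R (b i) = ((w x + c) * l i) • b i := by
        rw [hR, ← hxR, sqHess_apply, H.inner_grad_eq_zero hx hb h0, hb i, smul_smul]; simp
      have h2 := hidem (b i)
      rw [h1, map_smul, h1, smul_smul] at h2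
      have h3 := smul_left_injective ℝ (b.orthonormal.ne_zero i) h2
      have h4 : (w x + c) * l i ≠ 0 := mul_ne_zero hs h0
      have h5 : (w x + c) * l i = 1 := mul_right_cancel₀ h4 (by rw [one_mul]; exact h3)
      exact eq_inv_of_mul_eq_one_right h5
    have h1 := H.eventually_sqHess_eq hx hb (inv_ne_zero hs) hl
    rw [show 1 / (w x + c)⁻¹ - w x = c by rw [one_div, inv_inv]; ring] at h1
    filter_upwards [h1] with y hy
    rw [hy, hxR]
  have hs_pos : ∀ x ∈ S, 0 < w x + c := fun x hx => by
    by_contra! hneg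
    have hcont : ContinuousOn (fun x => w x + c) S :=
      H.toHasGradHessOn.continuousOn.add continuousOn_const
    obtain ⟨y, hyS, hy⟩ := hS.intermediate_value hx hx₀ hcont
      ⟨hneg, by simp only [hc]; have := one_div_pos.2 hm_pos; linarith⟩
    exact hs_ne y hyS (hconst y hyS) hy
  set V : E → E := fun x => (w x + c) • N x with hV
  have hRV : ∀ x ∈ S, R (V x) = V x := fun x hx => by
    rw [← hconst x hx, hV]; simp only; rw [map_smul, H.sqHess_grad c hx]
  have haff : ∀ x ∈ S, V x = R (x - (x₀ - V x₀)) := fun x hx => by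
    have hd : ∀ y ∈ S, HasFDerivAt (fun y => V y - R y) (0 : E →L[ℝ] E) y := fun y hy => by
      refine (((H.hasGradHessOn_sq c).hess y hy).sub R.hasFDerivAt).congr_fderiv ?_
      rw [hconst y hy, sub_self]
    have h1 := H.isOpen.is_const_of_fderiv_eq_zero (𝕜 := ℝ) hS
      (fun y hy => (hd y hy).differentiableAt.differentiableWithinAt)
      (fun y hy => (hd y hy).fderiv) hx hx₀
    rw [map_sub, map_sub, hRV x₀ hx₀]
    rw [eq_add_of_sub_eq h1]; abel
  have hw : ∀ x, 1 / m + (w x - w x₀) = w x + c := fun x => by rw [hc]; ring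
  refine ⟨1 + p, by omega, ?_, R, x₀ - V x₀, hsymm, hidem, by rw [htr]; push_cast; rfl,
    fun x hx => ?_⟩
  · have := trace_le_finrank_of_idempotent hsymm hidem
    rw [htr] at this
    exact_mod_cast this
  · rw [hk, hw x]
    refine ⟨hs_pos x hx, ?_, ?_⟩
    · have h1 := H.trace_sqHess c hx
      rw [hconst x hx, htr] at h1
      rw [eq_div_iff (hs_pos x hx).ne']
      push_cast
      linarith
    · rw [← haff x hx, hV]
      simp only
      rw [norm_smul, H.norm_grad x hx, mul_one, Real.norm_eq_abs, abs_of_pos (hs_pos x hx)]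

end IsoDist

end

/-! ### Functions with `|∇u| = f(u)` and `Δu = g(u)` -/

section

variable {E : Type*} [NormedAddCommGroup E] [InnerProductSpace ℝ E] [FiniteDimensional ℝ E]

lemma contDiffOn_gradient {Ω : Set E} (hΩ : IsOpen Ω) {u : E → ℝ} (hu : ContDiffOn ℝ 2 u Ω) :
    ContDiffOn ℝ 1 (∇ u) Ω :=
  (InnerProductSpace.toDual ℝ E).symm.toContinuousLinearEquiv.contDiff.comp_contDiffOn
    (hu.fderiv_of_isOpen hΩ (by norm_num))

lemma hasGradHessOn_of_contDiffOn {Ω : Set E} (hΩ : IsOpen Ω) {u : E → ℝ}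
    (hu : ContDiffOn ℝ 2 u Ω) : HasGradHessOn Ω u (∇ u) (fderiv ℝ (∇ u)) :=
  ⟨fun x hx => ((hu.differentiableOn (by norm_num)).differentiableAt
      (hΩ.mem_nhds hx)).hasGradientAt,
    fun x hx => (((contDiffOn_gradient hΩ hu).differentiableOn (by norm_num)).differentiableAt
      (hΩ.mem_nhds hx)).hasFDerivAt⟩

lemma HasGradHessOn.iteratedFDeriv_two {S : Set E} {u : E → ℝ} {H : E → E →L[ℝ] E}
    (h : HasGradHessOn S u (∇ u) H) {x : E} (hx : x ∈ S) (a b : E) :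
    iteratedFDeriv ℝ 2 u x ![a, b] = ⟪H x a, b⟫ := by
  have h1 : fderiv ℝ u = fun y => innerSL ℝ (∇ u y) := (toDual_comp_gradient (f := u)).symm
  have h2 : HasFDerivAt (fun y => innerSL ℝ (∇ u y))
      ((innerSL ℝ : E →L[ℝ] E →L[ℝ] ℝ).comp (H x)) x :=
    (innerSL ℝ : E →L[ℝ] E →L[ℝ] ℝ).hasFDerivAt.comp x (h.hess x hx)
  rw [iteratedFDeriv_two_apply, h1, h2.fderiv]
  simp

lemma HasGradHessOn.laplacian_eq {S : Set E} {u : E → ℝ} {H : E → E →L[ℝ] E}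
    (h : HasGradHessOn S u (∇ u) H) {x : E} (hx : x ∈ S) :
    (Δ u) x = LinearMap.trace ℝ E (H x) := by
  rw [InnerProductSpace.laplacian_eq_iteratedFDeriv_orthonormalBasis u (stdOrthonormalBasis ℝ E),
    LinearMap.trace_eq_sum_inner _ (stdOrthonormalBasis ℝ E)]
  refine Finset.sum_congr rfl fun i _ => ?_
  rw [h.iteratedFDeriv_two hx, real_inner_comm]
  rfl

/-- Near a noncritical value `u` has a local section of class `C¹`, along a line in the gradient
direction. -/
lemma exists_local_section {Ω : Set E} (hΩ : IsOpen Ω) {u : E → ℝ} (hu : ContDiffOn ℝ 2 u Ω)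
    {x : E} (hx : x ∈ Ω) (hne : ∇ u x ≠ 0) :
    ∃ κ : ℝ → E, ContDiffAt ℝ 1 κ (u x) ∧ κ (u x) = x ∧
      ∀ᶠ t in 𝓝 (u x), κ t ∈ Ω ∧ u (κ t) = t := by
  set v := ∇ u x with hv
  set σ : ℝ → ℝ := fun τ => u (x + τ • v) with hσ
  have hx0 : x + (0 : ℝ) • v ∈ Ω := by simpa using hx
  have hσ0 : σ 0 = u x := by simp [hσ]
  have hline : ContDiff ℝ 1 fun τ : ℝ => x + τ • v := by fun_prop
  have hσc : ContDiffAt ℝ 1 σ 0 :=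
    ContDiffAt.comp (0 : ℝ) (g := u) (f := fun τ : ℝ => x + τ • v)
      ((hu.contDiffAt (hΩ.mem_nhds hx0)).of_le (by norm_num)) hline.contDiffAt
  have hd : HasDerivAt σ (‖v‖ ^ 2) 0 := by
    have := (hasGradHessOn_of_contDiffOn hΩ hu).line_grad hx0
    rwa [zero_smul, add_zero, ← hv, real_inner_self_eq_norm_sq] at this
  have hc : ‖v‖ ^ 2 ≠ 0 := by positivity
  set e : ℝ ≃L[ℝ] ℝ := ContinuousLinearEquiv.unitsEquivAut ℝ (Units.mk0 _ hc) with he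
  have hd' : HasFDerivAt σ (e : ℝ →L[ℝ] ℝ) 0 := by
    refine hd.hasFDerivAt.congr_fderiv ?_
    ext; simp [he]
  have hinv := hσc.to_localInverse hd' one_ne_zero
  have hstrict := hσc.hasStrictFDerivAt' hd' one_ne_zero
  have hright : ∀ᶠ t in 𝓝 (σ 0), σ (hσc.localInverse hd' one_ne_zero t) = t :=
    hstrict.eventually_right_inverse
  have h0 : hσc.localInverse hd' one_ne_zero (σ 0) = 0 := hstrict.localInverse_apply_image
  rw [hσ0] at hinv hright h0
  refine ⟨fun t => x + hσc.localInverse hd' one_ne_zero t • v,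
    contDiffAt_const.add (hinv.smul contDiffAt_const), by simp only [h0]; simp, ?_⟩
  have hcont : ContinuousAt (fun t => x + hσc.localInverse hd' one_ne_zero t • v) (u x) :=
    continuousAt_const.add (hinv.continuousAt.smul continuousAt_const)
  have hmem : ∀ᶠ t in 𝓝 (u x), x + hσc.localInverse hd' one_ne_zero t • v ∈ Ω :=
    hcont.preimage_mem_nhds (hΩ.mem_nhds (by simp only [h0]; exact hx0))
  filter_upwards [hmem, hright] with t h1 h2 using ⟨h1, h2⟩

section Regularity

variable {Ω : Set E} {u : E → ℝ} {f g : ℝ → ℝ}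

lemma gradient_ne_zero (hf : ∀ t ∈ u '' Ω, 0 < f t) (hgrad : ∀ x ∈ Ω, ‖∇ u x‖ = f (u x)) {x : E}
    (hx : x ∈ Ω) : ∇ u x ≠ 0 := by
  rw [← norm_ne_zero_iff, hgrad x hx]
  exact (hf _ (mem_image_of_mem u hx)).ne'

lemma isOpen_image (hΩ : IsOpen Ω) (hu : ContDiffOn ℝ 2 u Ω) (hf : ∀ t ∈ u '' Ω, 0 < f t)
    (hgrad : ∀ x ∈ Ω, ‖∇ u x‖ = f (u x)) : IsOpen (u '' Ω) := by
  refine isOpen_iff_mem_nhds.2 ?_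
  rintro _ ⟨x, hx, rfl⟩
  obtain ⟨κ, -, -, hκ⟩ := exists_local_section hΩ hu hx (gradient_ne_zero hf hgrad hx)
  filter_upwards [hκ] with t ht using ⟨κ t, ht.1, ht.2⟩

lemma contDiffOn_of_norm_gradient (hΩ : IsOpen Ω) (hu : ContDiffOn ℝ 2 u Ω)
    (hf : ∀ t ∈ u '' Ω, 0 < f t) (hgrad : ∀ x ∈ Ω, ‖∇ u x‖ = f (u x)) :
    ContDiffOn ℝ 1 f (u '' Ω) := by
  rintro _ ⟨x, hx, rfl⟩
  have hne := gradient_ne_zero hf hgrad hx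
  obtain ⟨κ, hκ, hκx, hev⟩ := exists_local_section hΩ hu hx hne
  have h1 : ContDiffAt ℝ 1 (fun t => ∇ u (κ t)) (u x) :=
    ContDiffAt.comp (u x) (g := ∇ u)
      (by rw [hκx]; exact (contDiffOn_gradient hΩ hu).contDiffAt (hΩ.mem_nhds hx)) hκ
  have h2 : ContDiffAt ℝ 1 (fun t => ‖∇ u (κ t)‖) (u x) := h1.norm ℝ (by rwa [hκx])
  refine (h2.congr_of_eventuallyEq ?_).contDiffWithinAt
  filter_upwards [hev] with t ht
  rw [hgrad _ ht.1, ht.2]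

lemma continuousOn_of_laplacian (hΩ : IsOpen Ω) (hu : ContDiffOn ℝ 2 u Ω)
    (hf : ∀ t ∈ u '' Ω, 0 < f t) (hgrad : ∀ x ∈ Ω, ‖∇ u x‖ = f (u x))
    (hlap : ∀ x ∈ Ω, (Δ u) x = g (u x)) : ContinuousOn g (u '' Ω) := by
  rintro _ ⟨x, hx, rfl⟩
  obtain ⟨κ, hκ, hκx, hev⟩ := exists_local_section hΩ hu hx (gradient_ne_zero hf hgrad hx)
  have hH := hasGradHessOn_of_contDiffOn hΩ hu
  have hDc : ContinuousAt (fderiv ℝ (∇ u)) x :=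
    ((contDiffOn_gradient hΩ hu).continuousOn_fderiv_of_isOpen hΩ le_rfl).continuousAt
      (hΩ.mem_nhds hx)
  have hDκ : ContinuousAt (fun t => fderiv ℝ (∇ u) (κ t)) (u x) :=
    ContinuousAt.comp (g := fderiv ℝ (∇ u)) (by rwa [hκx]) hκ.continuousAt
  have h1 : ContinuousAt (fun t => ∑ i, ⟪stdOrthonormalBasis ℝ E i,
      fderiv ℝ (∇ u) (κ t) (stdOrthonormalBasis ℝ E i)⟫) (u x) := by
    refine tendsto_finsetSum _ fun i _ => ?_
    exact Filter.Tendsto.inner continuousAt_const (hDκ.clm_apply continuousAt_const)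
  refine (h1.congr_of_eventuallyEq ?_).continuousWithinAt
  filter_upwards [hev] with t ht
  rw [← ht.2, ← hlap _ ht.1, hH.laplacian_eq ht.1,
    LinearMap.trace_eq_sum_inner _ (stdOrthonormalBasis ℝ E), ht.2]
  rfl

end Regularity

lemma hasDerivAt_recipPrimitive {I : Set ℝ} (hI : IsOpen I) (hIc : I.OrdConnected) {f : ℝ → ℝ}
    (hf : ∀ t ∈ I, 0 < f t) (hfc : ContinuousOn f I) {a t : ℝ} (ha : a ∈ I) (ht : t ∈ I) :
    HasDerivAt (Segre.recipPrimitive f a) (1 / f t) t := by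
  have hc : ContinuousOn (fun s => 1 / f s) I :=
    continuousOn_const.div hfc fun s hs => (hf s hs).ne'
  exact intervalIntegral.integral_hasDerivAt_right
    (hc.mono (hIc.uIcc_subset ha ht)).intervalIntegrable
    (hc.stronglyMeasurableAtFilter hI t ht) (hc.continuousAt (hI.mem_nhds ht))

lemma strictMonoOn_recipPrimitive {I : Set ℝ} (hI : IsOpen I) (hIc : I.OrdConnected) {f : ℝ → ℝ}
    (hf : ∀ t ∈ I, 0 < f t) (hfc : ContinuousOn f I) {a : ℝ} (ha : a ∈ I) :
    StrictMonoOn (Segre.recipPrimitive f a) I := by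
  have hd := fun t (ht : t ∈ I) => hasDerivAt_recipPrimitive hI hIc hf hfc ha ht
  refine strictMonoOn_of_deriv_pos hIc.convex
    (fun t ht => (hd t ht).continuousAt.continuousWithinAt) fun t ht => ?_
  rw [(hd t (interior_subset ht)).deriv]
  exact one_div_pos.2 (hf t (interior_subset ht))

lemma _root_.Set.InjOn.invOn_invFunOn_image {α β : Type*} [Nonempty α] {F : α → β} {I : Set α}
    (hF : InjOn F I) : InvOn (Function.invFunOn F I) F I (F '' I) :=
  ⟨hF.leftInvOn_invFunOn, (surjOn_image F I).rightInvOn_invFunOn⟩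

/-- Composing `u` with a primitive `F` of `1/f` gives an isoparametric distance function, whose
Laplacian is the 1-Laplacian `g/f - f'` of `u`. -/
lemma exists_isoDist {Ω : Set E} (hΩ : IsOpen Ω) (hΩc : IsPreconnected Ω) {u : E → ℝ}
    (hu : ContDiffOn ℝ 2 u Ω) {f g : ℝ → ℝ} (hf : ∀ t ∈ u '' Ω, 0 < f t)
    (hgrad : ∀ x ∈ Ω, ‖∇ u x‖ = f (u x)) (hlap : ∀ x ∈ Ω, (Δ u) x = g (u x))
    {a : ℝ} (ha : a ∈ u '' Ω) :
    ∃ (A : E → E →L[ℝ] E) (h : ℝ → ℝ),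
      IsoDist Ω (fun x => Segre.recipPrimitive f a (u x)) (fun x => (1 / f (u x)) • ∇ u x) A h ∧
      (∀ x ∈ Ω, h (Segre.recipPrimitive f a (u x)) = g (u x) / f (u x) - deriv f (u x)) ∧
      ∀ x ∈ Ω, iteratedFDeriv ℝ 2 u x ![∇ u x, ∇ u x] = deriv f (u x) * f (u x) ^ 3 := by
  have hIo := isOpen_image hΩ hu hf hgrad
  have hIc : (u '' Ω).OrdConnected := (hΩc.image u hu.continuousOn).ordConnected
  have hfC := contDiffOn_of_norm_gradient hΩ hu hf hgrad
  have hH := hasGradHessOn_of_contDiffOn hΩ hu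
  have hmem : ∀ x ∈ Ω, u x ∈ u '' Ω := fun x hx => mem_image_of_mem u hx
  have hfd : ∀ t ∈ u '' Ω, HasDerivAt f (deriv f t) t := fun t ht =>
    ((hfC.differentiableOn (by norm_num)).differentiableAt (hIo.mem_nhds ht)).hasDerivAt
  set F := Segre.recipPrimitive f a with hF
  have hFinj : InjOn F (u '' Ω) :=
    (strictMonoOn_recipPrimitive hIo hIc hf hfC.continuousOn ha).injOn
  have hw := hH.comp_real (φ := F) (φ' := fun t => 1 / f t) (φ'' := fun t => -deriv f t / f t ^ 2)
    (fun x hx => hasDerivAt_recipPrimitive hIo hIc hf hfC.continuousOn ha (hmem x hx))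
    (fun x hx => by
      have h1 := (hfd _ (hmem x hx)).inv (hf _ (hmem x hx)).ne'
      simp only [one_div]
      exact h1)
  set A : E → E →L[ℝ] E := fun x => (1 / f (u x)) • fderiv ℝ (∇ u) x +
    ((-deriv f (u x) / f (u x) ^ 2) • innerSL ℝ (∇ u x)).smulRight (∇ u x) with hA
  set q : ℝ → ℝ := fun t => g t / f t - deriv f t with hq
  have hdist : IsoDist Ω (fun x => F (u x)) (fun x => (1 / f (u x)) • ∇ u x) A
      (fun s => q (Function.invFunOn F (u '' Ω) s)) := by
    refine ⟨hw, hΩ, fun x hx => ?_, ?_, fun x hx => ?_⟩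
    · have h0 := hf _ (hmem x hx)
      rw [norm_smul, hgrad x hx, Real.norm_eq_abs, abs_of_pos (one_div_pos.2 h0),
        one_div_mul_cancel h0.ne']
    · have huc := hu.continuousOn
      have hfu : ContinuousOn (fun x => f (u x)) Ω := hfC.continuousOn.comp huc hmem
      have hdfu : ContinuousOn (fun x => deriv f (u x)) Ω :=
        (hfC.continuousOn_deriv_of_isOpen hIo le_rfl).comp huc hmem
      have hfne : ∀ x ∈ Ω, f (u x) ≠ 0 := fun x hx => (hf _ (hmem x hx)).ne'
      have hDc := (contDiffOn_gradient hΩ hu).continuousOn_fderiv_of_isOpen hΩ le_rfl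
      have hGc := (contDiffOn_gradient hΩ hu).continuousOn
      have h1 : ContinuousOn (fun x => (-deriv f (u x) / f (u x) ^ 2) • innerSL ℝ (∇ u x)) Ω :=
        (hdfu.neg.div (hfu.pow 2) fun x hx => pow_ne_zero 2 (hfne x hx)).smul
          ((innerSL ℝ).continuous.comp_continuousOn hGc)
      have h2 : Continuous fun p : (E →L[ℝ] ℝ) × E => p.1.smulRight p.2 :=
        isBoundedBilinearMap_smulRight.continuous
      exact ((continuousOn_const.div hfu hfne).smul hDc).add
        (h2.comp_continuousOn (h1.prodMk hGc))
    · have h0 := (hf _ (hmem x hx)).ne'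
      rw [hFinj.leftInvOn_invFunOn (hmem x hx), hA]
      simp only
      rw [ContinuousLinearMap.toLinearMap_add, map_add, ContinuousLinearMap.toLinearMap_smul,
        map_smul, ← hH.laplacian_eq hx, hlap x hx, ← map_smul, trace_smulRight,
        real_inner_smul_left, real_inner_self_eq_norm_sq, hgrad x hx, smul_eq_mul, hq]
      simp only
      field_simp
      ring
  refine ⟨A, _, hdist, fun x hx => ?_, fun x hx => ?_⟩
  · rw [hFinj.leftInvOn_invFunOn (hmem x hx)]
  · have h0 := (hf _ (hmem x hx)).ne'
    have h1 := hdist.hess_grad hx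
    rw [map_smul, smul_eq_zero_iff_right (one_div_ne_zero h0)] at h1
    have h2 : ⟪A x (∇ u x), ∇ u x⟫ = 0 := by rw [h1, inner_zero_left]
    simp only [hA, _root_.add_apply, _root_.smul_apply, ContinuousLinearMap.smulRight_apply,
      innerSL_apply_apply, inner_add_left, real_inner_smul_left, smul_eq_mul,
      real_inner_self_eq_norm_sq, hgrad x hx] at h2
    rw [hH.iteratedFDeriv_two hx]
    field_simp at h2
    linarith

/-- A symmetric idempotent operator of `ℝⁿ` is given by a symmetric projection matrix. -/
lemma exists_mem_Pr {n k : ℕ} {R : EuclideanSpace ℝ (Fin n) →L[ℝ] EuclideanSpace ℝ (Fin n)}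
    (hs : ∀ a b, ⟪R a, b⟫ = ⟪a, R b⟫) (hR : ∀ a, R (R a) = R a)
    (ht : LinearMap.trace ℝ (EuclideanSpace ℝ (Fin n)) R = k) :
    ∃ R₀ ∈ Segre.Pr n k, ∀ a, Matrix.toEuclideanLin R₀ a = R a := by
  set b := (EuclideanSpace.basisFun (Fin n) ℝ) with hb
  refine ⟨LinearMap.toMatrix b.toBasis b.toBasis (R : _ →ₗ[ℝ] _), ⟨?_, ?_, ?_⟩, fun a => ?_⟩
  · ext i j
    rw [Matrix.transpose_apply, LinearMap.toMatrix_apply, LinearMap.toMatrix_apply]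
    simp only [OrthonormalBasis.coe_toBasis, OrthonormalBasis.coe_toBasis_repr_apply,
      OrthonormalBasis.repr_apply_apply, ContinuousLinearMap.coe_coe]
    rw [← hs, real_inner_comm]
  · rw [← LinearMap.toMatrix_comp]
    congr 1
    ext1 a
    exact hR a
  · rw [← ht, LinearMap.trace_eq_matrix_trace ℝ b.toBasis]
  · rw [Matrix.toEuclideanLin_eq_toLin_orthonormal, ← hb, Matrix.toLin_toMatrix]
    rfl

end

end Isoparametric

theorem mainTheorem1 (n : ℕ) (hn : 2 ≤ n)
    (Ω : Set (EuclideanSpace ℝ (Fin n))) (hΩ : IsOpen Ω) (hΩc : IsConnected Ω)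
    (u : EuclideanSpace ℝ (Fin n) → ℝ) (hu : ContDiffOn ℝ 2 u Ω)
    (f g : ℝ → ℝ) (hf : ∀ t ∈ u '' Ω, 0 < f t)
    (hgrad : ∀ x ∈ Ω, ‖∇ u x‖ = f (u x))
    (hlap : ∀ x ∈ Ω, (Δ u) x = g (u x)) :
    -- `u(Ω)` is an open interval, `f` is `C¹` on it and `g` is continuous on it
    (IsOpen (u '' Ω) ∧ (u '' Ω).OrdConnected ∧
      ContDiffOn ℝ 1 f (u '' Ω) ∧ ContinuousOn g (u '' Ω)) ∧
    -- first case: the 1-Laplacian vanishes at some point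
    (∀ x₀ ∈ Ω, Segre.oneLaplacian u x₀ = 0 →
      (∀ t ∈ u '' Ω, g t = f t * deriv f t) ∧
      ∃ U : ℝ → ℝ,
        Set.InvOn U (Segre.recipPrimitive f (u x₀)) (u '' Ω)
          (Segre.recipPrimitive f (u x₀) '' (u '' Ω)) ∧
        ∃ q : EuclideanSpace ℝ (Fin n), ‖q‖ = 1 ∧
          ∀ x ∈ Ω, ⟪q, x - x₀⟫ ∈ Segre.recipPrimitive f (u x₀) '' (u '' Ω) ∧
            u x = U ⟪q, x - x₀⟫) ∧
    -- second case: the 1-Laplacian is positive at some point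
    (∀ x₀ ∈ Ω, 0 < Segre.oneLaplacian u x₀ →
      ∃ k : ℕ, 2 ≤ k ∧ k ≤ n ∧
        (∀ t ∈ u '' Ω, 0 < Segre.shiftedPrimitive f (u x₀) (Segre.oneLaplacian u x₀) k t) ∧
        (∀ t ∈ u '' Ω, g t = f t * (deriv f t +
          ((k : ℝ) - 1) / Segre.shiftedPrimitive f (u x₀) (Segre.oneLaplacian u x₀) k t)) ∧
        ∃ U : ℝ → ℝ,
          Set.InvOn U (Segre.shiftedPrimitive f (u x₀) (Segre.oneLaplacian u x₀) k) (u '' Ω)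
            (Segre.shiftedPrimitive f (u x₀) (Segre.oneLaplacian u x₀) k '' (u '' Ω)) ∧
          ∃ R₀ ∈ Segre.Pr n k, ∃ xstar : EuclideanSpace ℝ (Fin n),
            ∀ x ∈ Ω, Matrix.toEuclideanLin R₀ (x - xstar) ≠ 0 ∧
              ‖Matrix.toEuclideanLin R₀ (x - xstar)‖ ∈
                Segre.shiftedPrimitive f (u x₀) (Segre.oneLaplacian u x₀) k '' (u '' Ω) ∧
              u x = U ‖Matrix.toEuclideanLin R₀ (x - xstar)‖) := by
  have hIo := Isoparametric.isOpen_image hΩ hu hf hgrad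
  have hIc : (u '' Ω).OrdConnected := (hΩc.isPreconnected.image u hu.continuousOn).ordConnected
  have hfC := Isoparametric.contDiffOn_of_norm_gradient hΩ hu hf hgrad
  have hmem : ∀ x ∈ Ω, u x ∈ u '' Ω := fun x hx => Set.mem_image_of_mem u hx
  have hinj : ∀ x₀ ∈ Ω, Set.InjOn (Segre.recipPrimitive f (u x₀)) (u '' Ω) := fun x₀ hx₀ =>
    (Isoparametric.strictMonoOn_recipPrimitive hIo hIc hf hfC.continuousOn (hmem x₀ hx₀)).injOn
  have hF0 : ∀ x₀, Segre.recipPrimitive f (u x₀) (u x₀) = 0 := fun x₀ =>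
    intervalIntegral.integral_same
  -- the 1-Laplacian of `u` is the Laplacian of `F ∘ u`
  have hone : ∀ x₀ ∈ Ω, ∀ h : ℝ → ℝ,
      (∀ x ∈ Ω, h (Segre.recipPrimitive f (u x₀) (u x)) = g (u x) / f (u x) - deriv f (u x)) →
      (∀ x ∈ Ω, iteratedFDeriv ℝ 2 u x ![∇ u x, ∇ u x] = deriv f (u x) * f (u x) ^ 3) →
      Segre.oneLaplacian u x₀ = h (Segre.recipPrimitive f (u x₀) (u x₀)) := by
    intro x₀ hx₀ h hh hit
    have h0 := (hf _ (hmem x₀ hx₀)).ne'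
    rw [hh x₀ hx₀, Segre.oneLaplacian, Segre.normalizedInftyLaplacian, hlap x₀ hx₀, hit x₀ hx₀,
      hgrad x₀ hx₀]
    field_simp
  refine ⟨⟨hIo, hIc, hfC, Isoparametric.continuousOn_of_laplacian hΩ hu hf hgrad hlap⟩,
    fun x₀ hx₀ hzero => ?_, fun x₀ hx₀ hpos => ?_⟩
  · obtain ⟨A, h, hD, hh, hit⟩ := Isoparametric.exists_isoDist hΩ hΩc.isPreconnected hu hf hgrad
      hlap (hmem x₀ hx₀)
    rw [hone x₀ hx₀ h hh hit] at hzero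
    obtain ⟨h1, h2⟩ := hD.eq_inner_of_trace_eq_zero hΩc.isPreconnected hx₀ hzero
    refine ⟨?_, Function.invFunOn (Segre.recipPrimitive f (u x₀)) (u '' Ω),
      (hinj x₀ hx₀).invOn_invFunOn_image, _, hD.norm_grad x₀ hx₀, fun x hx => ?_⟩
    · rintro _ ⟨x, hx, rfl⟩
      have h3 := h1 x hx
      have h0 := (hf _ (hmem x hx)).ne'
      rw [hh x hx] at h3
      field_simp at h3
      linarith
    · rw [← h2 x hx, hF0, sub_zero]
      exact ⟨Set.mem_image_of_mem _ (hmem x hx),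
        ((hinj x₀ hx₀).leftInvOn_invFunOn (hmem x hx)).symm⟩
  · obtain ⟨A, h, hD, hh, hit⟩ := Isoparametric.exists_isoDist hΩ hΩc.isPreconnected hu hf hgrad
      hlap (hmem x₀ hx₀)
    have hC := hone x₀ hx₀ h hh hit
    obtain ⟨k, hk2, hkn, R, z, hs, hR, htr, hall⟩ :=
      hD.eq_norm_of_trace_pos hΩc.isPreconnected hx₀ (hC ▸ hpos)
    rw [finrank_euclideanSpace_fin] at hkn
    rw [hF0] at hC
    simp only [hF0, sub_zero, ← hC] at hall
    obtain ⟨R₀, hR₀, hR₀R⟩ := Isoparametric.exists_mem_Pr hs hR htr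
    have hFk : ∀ t, Segre.shiftedPrimitive f (u x₀) (Segre.oneLaplacian u x₀) k t =
      ((k : ℝ) - 1) / Segre.oneLaplacian u x₀ + Segre.recipPrimitive f (u x₀) t := fun _ => rfl
    have hinjk : Set.InjOn (Segre.shiftedPrimitive f (u x₀) (Segre.oneLaplacian u x₀) k)
        (u '' Ω) := fun s hs t ht hst => hinj x₀ hx₀ hs ht (by
      rw [hFk, hFk] at hst
      exact add_left_cancel hst)
    refine ⟨k, hk2, hkn, ?_, ?_, _, hinjk.invOn_invFunOn_image, R₀, hR₀, z, fun x hx => ?_⟩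
    · rintro _ ⟨x, hx, rfl⟩
      exact (hall x hx).1
    · rintro _ ⟨x, hx, rfl⟩
      have h3 := (hall x hx).2.1
      have h0 := (hf _ (hmem x hx)).ne'
      rw [hh x hx] at h3
      rw [hFk, ← h3]
      field_simp
      ring
    · rw [hR₀R, ← norm_ne_zero_iff, (hall x hx).2.2, ← hFk]
      exact ⟨(hall x hx).1.ne', Set.mem_image_of_mem _ (hmem x hx),
        (hinjk.leftInvOn_invFunOn (hmem x hx)).symm⟩
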